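/- **Setting.** Let $\mathbb{P}=\mathrm{Trop}(z_1,\dots,z_m)$ be the tropical semifield: the free abelian group (written multiplicatively) on $z_1,\dots,z_m$ with auxiliary addition $\prod_j z_j^{a_j}\oplus\prod_j z_j^{b_j}=\prod_j z_j^{\min(a_j,b_j)}$. Its group ring is $\mathbb{Z}\mathbb{P}=\mathbb{Z}[z_1^{\pm1},\dots,z_m^{\pm1}]$, and $\mathbb{Z}\mathbb{P}_+=\mathbb{Z}[z_1,\dots,z_m]\subseteq\mathbb{Z}\mathbb{P}$. Let $\mathcal{F}$ be a field containing $\mathbb{Z}\mathbb{P}$. A *seed* of rank $n$ in $\mathcal{F}$ is a triple $(\mathbf{x},\mathbf{y},B)$, where $\mathbf{x}=(x_1,\dots,x_n)$ freely generates $\mathcal{F}$ as a field over the fraction field of $\mathbb{Z}\mathbb{P}$, $\mathbf{y}\in\mathbb{P}^n$, and $B$ is an integral skew-symmetrizable $n\times n$ matrix. With $[b]_+=\max(b,0)$, the mutation of the seed in direction $k\in\{1,\dots,n\}$ is $(\mathbf{x}',\mathbf{y}',B')$ with $x_i'=x_i$ for $i\ne k$, $$x_k'=\frac{y_k\prod_j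 x_j^{[B_{jk}]_+}+\prod_j x_j^{[-B_{jk}]_+}}{(y_k\oplus1)\,x_k},\qquad y_k'=y_k^{-1},\qquad y_i'=y_i\,y_k^{[B_{ki}]_+}(y_k\oplus1)^{-B_{ki}}\ \ (i\neq k),$$ $$B'_{ij}=-B_{ij}\ \text{ if } i=k \text{ or } j=k,\qquad B'_{ij}=B_{ij}+\tfrac12\bigl(|B_{ik}|B_{kj}+B_{ik}|B_{kj}|\bigr)\ \text{ otherwise}.$$ Two seeds are *mutation equivalent* if one is obtained from the other by a finite sequence of mutations, up to permuting the indices. A *quiver* here is a finite directed graph without loops or directed $2$-cycles (parallel arrows allowed), with mutable vertices $1,\dots,n$ and frozen vertices $z_1,\dots,z_m$, and with no arrows between frozen vertices. A quiver $Q$ together with an $n$-tuple $\mathbf{x}$ freely generating $\mathcal{F}$ over the fraction field of $\mathbb{Z}\mathbb{P}$ defines the seed $(\mathbf{x},\mathbf{y},B)$ in which $$B_{ji}=\#\{i\to j\}-\#\{j\to i\},\qquad y_i=\prod_{j=1}^m z_j^{\#\{i\to z_j\}-\#\{z_j\to i\}}.$$ Let $\mathcal{A}$ be the $\mathbb{Z}\mathbb{P}_+$-subalgebra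 of $\mathcal{F}$ generated by the elements of the clusters of all seeds mutation equivalent to this seed, and let $$\mathcal{U}=\bigcap_{(\mathbf{x}',\mathbf{y}',B')}\mathbb{Z}\mathbb{P}_+\bigl[x_1'^{\pm1},\dots,x_n'^{\pm1}\bigr]\subseteq\mathcal{F},$$ the intersection being over all seeds mutation equivalent to this seed. **Corollary 3.7.** Suppose that $Q$ is acyclic (there is no directed cycle of mutable vertices) and that every arrow of $Q$ involving a frozen vertex points from a mutable vertex to a frozen vertex. Then $\mathcal{A}=\mathcal{U}$. -/

import Mathlib

namespace ClusterAlg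

/-- A semifield: a torsion-free abelian group (written multiplicatively) with an auxiliary
addition that is commutative, associative, and distributive over multiplication. -/
class CoeffSemifield (P : Type*) [CommGroup P] : Type _ extends IsMulTorsionFree P where
  oplus : P → P → P
  oplus_comm : ∀ a b, oplus a b = oplus b a
  oplus_assoc : ∀ a b c, oplus (oplus a b) c = oplus a (oplus b c)
  mul_oplus : ∀ a b c, a * oplus b c = oplus (a * b) (a * c)

/-- The underlying group of the tropical semifield on `m` generators: the free abelian group
on `m` generators, written multiplicatively; its elements are exponent vectors. -/
abbrev Trop (m : ℕ) : Type := Multiplicative (Fin m → ℤ)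

/-- The tropical addition: the componentwise minimum of exponents. -/
instance (m : ℕ) : CoeffSemifield (Trop m) where
  oplus a b := Multiplicative.ofAdd (fun j => min (a.toAdd j) (b.toAdd j))
  oplus_comm a b := by
    apply Multiplicative.toAdd.injective
    funext j
    exact min_comm _ _
  oplus_assoc a b c := by
    apply Multiplicative.toAdd.injective
    funext j
    exact min_assoc _ _ _
  mul_oplus a b c := by
    apply Multiplicative.toAdd.injective
    funext j
    exact (min_add_add_left _ _ _).symm

/-- The `j`-th generator `z_j` of the tropical semifield. -/
def Trop.z {m : ℕ} (j : Fin m) : Trop m := Multiplicative.ofAdd (Pi.single j 1)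

/-- The polynomial ground ring `ℤ[z_1, …, z_m]`, as the subring of the group ring
`ℤ[z_1^{±1}, …, z_m^{±1}]` of the tropical semifield generated by the `z_j`. -/
noncomputable def polyGroundRing (m : ℕ) : Subring (MonoidAlgebra ℤ (Trop m)) :=
  Subring.closure (Set.range fun j : Fin m => MonoidAlgebra.of ℤ (Trop m) (Trop.z j))

/-- The data `(x, y, B)` of a labeled seed of rank `n`. The conditions on these data are
in `Seed.IsSeed`. -/
@[ext]
structure Seed (P F : Type*) (n : ℕ) where
  /-- the cluster -/
  x : Fin n → F
  /-- the coefficients -/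
  y : Fin n → P
  /-- the exchange matrix -/
  B : Matrix (Fin n) (Fin n) ℤ

namespace Seed

section Basic

variable {P F : Type*} {n : ℕ}

/-- Relabeling the indices of a seed by a permutation. -/
def permute (σ : Equiv.Perm (Fin n)) (s : Seed P F n) : Seed P F n where
  x i := s.x (σ i)
  y i := s.y (σ i)
  B i j := s.B (σ i) (σ j)

end Basic

section General

variable {P F : Type*} [CommGroup P] [Field F] [Algebra (MonoidAlgebra ℤ P) F] {n : ℕ}

/-- The conditions for `(x, y, B)` to be a seed in the field `F ⊇ ℤP`: `x` freely generates `F`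
as a field over the fraction field of `ℤP` (formed inside `F`), and `B` is skew-symmetrizable,
i.e. `D B` is skew-symmetric for a diagonal matrix `D` with positive integer entries. -/
structure IsSeed (s : Seed P F n) : Prop where
  algebraicIndependent : AlgebraicIndependent
    (Subfield.closure (Set.range (algebraMap (MonoidAlgebra ℤ P) F))) s.x
  adjoin_eq_top : IntermediateField.adjoin
    (Subfield.closure (Set.range (algebraMap (MonoidAlgebra ℤ P) F))) (Set.range s.x) = ⊤
  skewSymmetrizable : ∃ d : Fin n → ℤ, (∀ i, 0 < d i) ∧
    ∀ i j, d i * s.B i j = -(d j * s.B j i)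

variable [CoeffSemifield P]

/-- Seed mutation in direction `k`. Here `Int.toNat b` is `[b]₊ = max b 0`, and the division
by `2` in the rule for `B` is exact. -/
noncomputable def mutate (k : Fin n) (s : Seed P F n) : Seed P F n where
  x i :=
    if i = k then
      (algebraMap (MonoidAlgebra ℤ P) F (MonoidAlgebra.of ℤ P (s.y k))
            * ∏ j, s.x j ^ (s.B j k).toNat
          + ∏ j, s.x j ^ (-s.B j k).toNat)
        / (algebraMap (MonoidAlgebra ℤ P) F
            (MonoidAlgebra.of ℤ P (CoeffSemifield.oplus (s.y k) 1)) * s.x k)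
    else s.x i
  y i :=
    if i = k then (s.y k)⁻¹
    else s.y i * s.y k ^ (s.B k i).toNat * CoeffSemifield.oplus (s.y k) 1 ^ (-s.B k i)
  B i j :=
    if i = k ∨ j = k then -s.B i j
    else s.B i j + (|s.B i k| * s.B k j + s.B i k * |s.B k j|) / 2

/-- `s.MutEquiv t`: the seed `t` is obtained from `s` by a finite sequence of mutations, up to
permuting the indices. -/
def MutEquiv (s t : Seed P F n) : Prop :=
  ∃ s' : Seed P F n, Relation.ReflTransGen (fun a b => ∃ k, b = mutate k a) s s' ∧
    ∃ σ : Equiv.Perm (Fin n), t = s'.permute σ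

/-- The cluster variables: the elements of the clusters of all seeds mutation equivalent
to `s`. -/
def clusterVariables (s : Seed P F n) : Set F :=
  {f | ∃ t : Seed P F n, s.MutEquiv t ∧ ∃ i, f = t.x i}

/-- The cluster algebra over the ground ring `A`: the unital `A`-subalgebra of `F` generated by
all cluster variables. -/
noncomputable def clusterAlgebra (A : Subring (MonoidAlgebra ℤ P)) (s : Seed P F n) : Subalgebra A F :=
  Algebra.adjoin A s.clusterVariables

/-- The ring `A[x_1^{±1}, …, x_n^{±1}] ⊆ F` of Laurent polynomials in the cluster of `s`. -/
noncomputable def laurentRing (A : Subring (MonoidAlgebra ℤ P)) (s : Seed P F n) : Subalgebra A F :=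
  Algebra.adjoin A (Set.range s.x ∪ Set.range fun i => (s.x i)⁻¹)

/-- The upper cluster algebra over the ground ring `A`: the intersection of the rings of Laurent
polynomials in the clusters of all seeds mutation equivalent to `s`. -/
noncomputable def upperClusterAlgebra (A : Subring (MonoidAlgebra ℤ P)) (s : Seed P F n) : Subalgebra A F :=
  ⨅ (t : Seed P F n) (_ : s.MutEquiv t), laurentRing A t

end General

end Seed

/-- A quiver with mutable vertices `Sum.inl i` (`i : Fin n`) and frozen vertices `Sum.inr j`
(`j : Fin m`): a finite directed multigraph without loops or directed 2-cycles, and without arrows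
between frozen vertices. -/
structure IceQuiver (n m : ℕ) where
  /-- `arrows u v` is the number of arrows `u → v` -/
  arrows : Fin n ⊕ Fin m → Fin n ⊕ Fin m → ℕ
  no_loops : ∀ v, arrows v v = 0
  no_two_cycles : ∀ u v, arrows u v = 0 ∨ arrows v u = 0
  no_frozen_arrows : ∀ i j : Fin m, arrows (Sum.inr i) (Sum.inr j) = 0

namespace IceQuiver

variable {n m : ℕ}

/-- The seed of geometric type with cluster `x` defined by a quiver: `B_{ji}` is the number of
arrows `i → j`, and `y_i = ∏_j z_j ^ a_j` with `a_j` the number of arrows `i → z_j`; arrows in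
the opposite direction are counted negatively. -/
def seed {F : Type*} (Q : IceQuiver n m) (x : Fin n → F) : Seed (Trop m) F n where
  x := x
  y i := ∏ j : Fin m, Trop.z j ^
    ((Q.arrows (Sum.inl i) (Sum.inr j) : ℤ) - (Q.arrows (Sum.inr j) (Sum.inl i) : ℤ))
  B := Matrix.of fun j i =>
    (Q.arrows (Sum.inl i) (Sum.inl j) : ℤ) - (Q.arrows (Sum.inl j) (Sum.inl i) : ℤ)

/-- There is no directed cycle of mutable vertices. -/
def IsAcyclic (Q : IceQuiver n m) : Prop :=
  ∀ i : Fin n, ¬ Relation.TransGen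
    (fun a b : Fin n => 0 < Q.arrows (Sum.inl a) (Sum.inl b)) i i

/-- All arrows involving frozen vertices go from a mutable vertex to a frozen vertex. -/
def IsSourceFreezing (Q : IceQuiver n m) : Prop :=
  ∀ (j : Fin m) (v : Fin n ⊕ Fin m), Q.arrows (Sum.inr j) v = 0

end IceQuiver

end ClusterAlg

/-! The inclusion of the cluster algebra in the upper cluster algebra is the Laurent phenomenon with
polynomial dependence on the frozen variables. It is first proved for nondegenerate seeds with all
vertices mutable, in a field of rational functions over ℚ. For such a seed, the intersection of the
Laurent rings of the seed and its neighbours is unchanged by mutation. This is checked for two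
directions at a time. Joined directions give a rank two computation (`mem_laurent_of_rank_two`);
unjoined ones use that the two exchange binomials form a regular sequence, which is where
nondegeneracy enters (`IsNondegSeed.exch_regular`).

Frozen exponents are nonnegative because clusters are subtraction-free in the initial variables and
an exchange binomial stays positive when one frozen variable is set to 0
(`exists_laurent_of_reachable`). An arbitrary seed of geometric type is reached by specialization: a
second copy of all its vertices is attached to make the matrix invertible, and the added variables
are then set to 1 (`IsSkew.cluster_mem_laurentRing`).

For the other inclusion, let W(S) be generated by all x_i, by the exchanged variables x_i' for i in
S, and by x_i⁻¹ for i outside S. An element f of the upper cluster algebra lies in every W(S), by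
induction on S (`IsSkew.mem_partialAlgebra`). If S has no internal arrows, mutations at its vertices
do not interact, and f is handled one variable at a time by `mem_adjoin_pair_of_mem_laurent`.
Otherwise acyclicity gives a source i of S with an arrow i → j inside S. The relation x_i x_i' = z
x_j r + q then has q a monomial in variables outside S, without frozen factor because frozen arrows
point outward. So q is a unit, x_i and x_j are comaximal in W(S), and f lies in both localizations
by induction. Taking S to be all vertices leaves only cluster variables as generators. -/

namespace ClusterAlg

/-! ### Testing membership in localizations. -/

section Localization

variable {A F : Type*} [CommRing A] [Field F] [Algebra A F]

/-- If every generator lands in `W` after multiplication by a power of `g ∈ W`, then so does every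
element of the generated subalgebra. -/
theorem exists_pow_mul_mem_of_mem_adjoin (W : Subalgebra A F) {g : F} (hg : g ∈ W) {S : Set F}
    (hS : ∀ s ∈ S, ∃ N : ℕ, g ^ N * s ∈ W) {f : F} (hf : f ∈ Algebra.adjoin A S) :
    ∃ N : ℕ, g ^ N * f ∈ W := by
  induction hf using Algebra.adjoin_induction with
  | mem s hs => exact hS s hs
  | algebraMap r => exact ⟨0, by simp⟩
  | add u v _ _ hu hv =>
    obtain ⟨N, hN⟩ := hu
    obtain ⟨M, hM⟩ := hv
    refine ⟨N + M, ?_⟩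
    have := W.add_mem (W.mul_mem (W.pow_mem hg M) hN) (W.mul_mem (W.pow_mem hg N) hM)
    convert this using 1
    ring
  | mul u v _ _ hu hv =>
    obtain ⟨N, hN⟩ := hu
    obtain ⟨M, hM⟩ := hv
    refine ⟨N + M, ?_⟩
    have := W.mul_mem hN hM
    convert this using 1
    ring

/-- An element lying in two localizations at comaximal elements lies in the ring. -/
theorem mem_of_comaximal (W : Subalgebra A F) {g h u v f : F} (hg : g ∈ W) (hh : h ∈ W)
    (hu : u ∈ W) (hv : v ∈ W) (h1 : u * g + v * h = 1) {N M : ℕ} (hN : g ^ N * f ∈ W)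
    (hM : h ^ M * f ∈ W) : f ∈ W := by
  have hc : IsCoprime (⟨g, hg⟩ : W) ⟨h, hh⟩ := ⟨⟨u, hu⟩, ⟨v, hv⟩, Subtype.ext h1⟩
  obtain ⟨p, q, hpq⟩ := hc.pow (m := N) (n := M)
  have hpq' : (p : F) * g ^ N + q * h ^ M = 1 := congrArg Subtype.val hpq
  have : f = p * (g ^ N * f) + q * (h ^ M * f) := by linear_combination (-f) * hpq'
  rw [this]
  exact W.add_mem (W.mul_mem p.2 hN) (W.mul_mem q.2 hM)

/-- An element lying in two localizations at a regular sequence lies in the ring. -/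
theorem mem_of_regular (Z : Subalgebra A F) {p r f : F} (hp : p ∈ Z) (hr : r ∈ Z) (hr0 : r ≠ 0)
    (hreg : ∀ G ∈ Z, ∀ H ∈ Z, p * G = r * H → ∃ H' ∈ Z, G = r * H') {M N : ℕ}
    (hM : p ^ M * f ∈ Z) (hN : r ^ N * f ∈ Z) : f ∈ Z := by
  have key : ∀ M : ℕ, ∀ G ∈ Z, ∀ H ∈ Z, p ^ M * G = r * H → ∃ H' ∈ Z, G = r * H' := by
    intro M
    induction M with
    | zero => exact fun G _ H hH h => ⟨H, hH, by simpa using h⟩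
    | succ M ih =>
      intro G hG H hH h
      obtain ⟨H', hH', h'⟩ := hreg (p ^ M * G) (Z.mul_mem (Z.pow_mem hp M) hG) H hH
        (by rw [← h]; ring)
      exact ih G hG H' hH' h'
  induction N generalizing f with
  | zero => simpa using hN
  | succ N ih =>
    have h1 : r * f ∈ Z := by
      refine ih ?_ ?_
      · have := Z.mul_mem hr hM
        convert this using 1
        ring
      · convert hN using 1
        ring
    obtain ⟨H', hH', h⟩ := key M (r * f) h1 _ hM (by ring)
    rwa [mul_left_cancel₀ hr0 h]

end Localization

/-! ### One variable: Laurent in both a and P / a. -/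

section Laurent

open Polynomial

/-- Multiplying by the power a ^ d, with d the degree of `q`, gives the polynomial identity p X ^ d
= reverse q, and the right side has degree at most d. -/
theorem natDegree_eq_zero_of_aeval_eq_aeval_inv {E F : Type*} [Field E] [Field F] [Algebra E F]
    {a : F} (ha : Transcendental E a) {p q : E[X]} (h : aeval a p = aeval a⁻¹ q) :
    p.natDegree = 0 := by
  by_cases hp : p = 0
  · simp [hp]
  have ha0 : a ≠ 0 := by
    rintro rfl
    exact ha isAlgebraic_zero
  let _ : Invertible a⁻¹ := invertibleOfNonzero (inv_ne_zero ha0)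
  have h2 := eval₂_reverse_mul_pow (algebraMap E F) a⁻¹ q
  rw [invOf_eq_inv, inv_inv] at h2
  have h3 : aeval a (p * X ^ q.natDegree - q.reverse) = 0 := by
    rw [map_sub, map_mul, map_pow, aeval_X, h, sub_eq_zero]
    rw [aeval_def, aeval_def, ← h2, mul_assoc, ← mul_pow, inv_mul_cancel₀ ha0, one_pow, mul_one]
  have h4 : p * X ^ q.natDegree - q.reverse = 0 :=
    transcendental_iff.mp ha _ h3
  have h5 := congrArg natDegree (sub_eq_zero.mp h4)
  rw [natDegree_mul_X_pow _ hp] at h5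
  have := q.reverse_natDegree_le
  omega

variable {A F : Type*} [CommRing A] [Field F] [Algebra A F]

theorem exists_aeval_add_aeval_inv (R : Subalgebra A F) {a : F} (ha : a ≠ 0) {f : F}
    (hf : f ∈ Algebra.adjoin A ((R : Set F) ∪ {a, a⁻¹})) :
    ∃ u v : R[X], f = aeval a u + aeval a⁻¹ v := by
  have h1 : ∃ p : LaurentPolynomial R,
      LaurentPolynomial.eval₂ (algebraMap R F) (Units.mk0 a ha) p = f := by
    induction hf using Algebra.adjoin_induction with
    | mem s hs =>
      rcases hs with hs | hs | hs
      · exact ⟨LaurentPolynomial.C ⟨s, hs⟩, by simp⟩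
      · exact ⟨LaurentPolynomial.T 1, by
          rw [LaurentPolynomial.eval₂_T]; simpa using hs.symm⟩
      · exact ⟨LaurentPolynomial.T (-1), by
          rw [LaurentPolynomial.eval₂_T]; simpa using hs.symm⟩
    | algebraMap r => exact ⟨LaurentPolynomial.C (algebraMap A R r), by simp⟩
    | add u v _ _ hu hv =>
      obtain ⟨p, rfl⟩ := hu
      obtain ⟨q, rfl⟩ := hv
      exact ⟨p + q, map_add _ _ _⟩
    | mul u v _ _ hu hv =>
      obtain ⟨p, rfl⟩ := hu
      obtain ⟨q, rfl⟩ := hv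
      exact ⟨p * q, map_mul _ _ _⟩
  clear hf
  obtain ⟨p, rfl⟩ := h1
  induction p using LaurentPolynomial.induction_on' with
  | add p q hp hq =>
    obtain ⟨u, v, h⟩ := hp
    obtain ⟨u', v', h'⟩ := hq
    exact ⟨u + u', v + v', by rw [map_add, h, h']; simp; ring⟩
  | C_mul_T n r =>
    rcases Int.eq_nat_or_neg n with ⟨n, rfl | rfl⟩
    · exact ⟨C r * X ^ n, 0, by simp⟩
    · exact ⟨0, C r * X ^ n, by simp⟩

/-- Laurent polynomials in `a` that are also Laurent polynomials in `P / a`. -/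
theorem mem_adjoin_pair_of_mem_laurent (R : Subalgebra A F) (E : Subfield F)
    (hE : ∀ r ∈ R, r ∈ E) {a P : F} (ha : Transcendental E a) (hP : P ∈ R) (hP0 : P ≠ 0) {f : F}
    (h1 : f ∈ Algebra.adjoin A ((R : Set F) ∪ {a, a⁻¹}))
    (h2 : f ∈ Algebra.adjoin A ((R : Set F) ∪ {P / a, (P / a)⁻¹})) :
    f ∈ Algebra.adjoin A ((R : Set F) ∪ {a, P / a}) := by
  have ha0 : a ≠ 0 := by
    rintro rfl
    exact ha isAlgebraic_zero
  have hRle : ∀ (S : Set F), ∀ r ∈ R, r ∈ Algebra.adjoin A ((R : Set F) ∪ S) :=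
    fun S r hr => Algebra.subset_adjoin (Or.inl hr)
  have haev : ∀ (T : Subalgebra A F), (∀ r ∈ R, r ∈ T) → ∀ t ∈ T, ∀ p : R[X], aeval t p ∈ T := by
    intro T hT t ht p
    rw [aeval_eq_sum_range]
    refine T.sum_mem fun i _ => ?_
    rw [Algebra.smul_def]
    exact T.mul_mem (hT _ (p.coeff i).2) (T.pow_mem ht i)
  obtain ⟨u, v, huv⟩ := exists_aeval_add_aeval_inv R ha0 h1
  have ha' : a ∈ Algebra.adjoin A ((R : Set F) ∪ {P / a, (P / a)⁻¹}) := by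
    have : a = P * (P / a)⁻¹ := by field_simp
    have h := Subalgebra.mul_mem _ (hRle {P / a, (P / a)⁻¹} _ hP)
      (Algebra.subset_adjoin (Or.inr (Or.inr rfl)))
    rwa [← this] at h
  -- The element f - u(a) = v(1/a) has no positive powers of `a`; it is expanded a second time, in
  -- powers of P / a.
  obtain ⟨d, e, hde⟩ := exists_aeval_add_aeval_inv R (div_ne_zero hP0 ha0)
    (Subalgebra.sub_mem _ h2 (haev _ (hRle _) _ ha' u))
  let i : R →+* E := (algebraMap R F).codRestrict E.toSubring fun r => hE _ r.2
  have hi : (algebraMap E F).comp i = algebraMap R F := rfl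
  have hiinj : Function.Injective i := fun r s h => Subtype.ext (congrArg (fun z : E => (z : F)) h)
  have hmap : ∀ (t : F) (p : R[X]), aeval t (p.map i) = aeval t p := by
    intro t p
    rw [aeval_def, eval₂_map, hi, aeval_def]
  let PE : E := ⟨P, hE P hP⟩
  have hPE : PE ≠ 0 := fun h => hP0 (congrArg Subtype.val h)
  -- The part `e` is a polynomial in (P / a)⁻¹ = a / P, hence in `a`, while v(1/a) - d(P/a) is a
  -- polynomial in 1/a; so `e` is constant. Coefficients are taken in `E` because P⁻¹ need not lie
  -- in `R`.
  have heq : aeval a ((e.map i).comp (C PE⁻¹ * X)) =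
      aeval a⁻¹ (v.map i - (d.map i).comp (C PE * X)) := by
    have e1 : aeval a (C PE⁻¹ * X : E[X]) = (P / a)⁻¹ := by
      rw [map_mul, aeval_C, aeval_X, map_inv₀, inv_div, div_eq_inv_mul]; rfl
    have e2 : aeval a⁻¹ (C PE * X : E[X]) = P / a := by
      rw [map_mul, aeval_C, aeval_X, div_eq_mul_inv]; rfl
    rw [map_sub, aeval_comp, aeval_comp, e1, e2, hmap, hmap, hmap]
    linear_combination (-1 : F) * hde + huv
  have hdeg := natDegree_eq_zero_of_aeval_eq_aeval_inv ha heq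
  rw [natDegree_comp, natDegree_C_mul_X _ (inv_ne_zero hPE), mul_one,
    natDegree_map_eq_of_injective hiinj] at hdeg
  rw [eq_C_of_natDegree_eq_zero hdeg, aeval_C] at hde
  have hf : f = aeval a u + aeval (P / a) d + algebraMap R F (e.coeff 0) := by
    linear_combination hde
  rw [hf]
  exact Subalgebra.add_mem _ (Subalgebra.add_mem _
    (haev _ (hRle _) _ (Algebra.subset_adjoin (by simp)) _)
    (haev _ (hRle _) _ (Algebra.subset_adjoin (by simp)) _)) (hRle _ _ (e.coeff 0).2)

end Laurent

/-! ### Two joined directions. -/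

section RankTwo

variable {A F : Type*} [CommRing A] [Field F] [Algebra A F]

/-- The rank two step in the invariance of upper bounds under mutation, at two directions joined
by at least one arrow. -/
theorem mem_laurent_of_rank_two (R : Subalgebra A F) (E : Subfield F) (hE : ∀ r ∈ R, r ∈ E)
    {a b U V C D w f : F} (hb : b ∈ E) (hb0 : b ≠ 0) (ha : Transcendental E a)
    (hU : U ∈ R) (hV : V ∈ R) (hC : C ∈ R) (hD : D ∈ R) (hw : w ∈ R)
    (hC' : C⁻¹ ∈ R) (hC0 : C ≠ 0) (hw' : w⁻¹ ∈ R) (hw0 : w ≠ 0) {c : ℕ} (hc : c ≠ 0)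
    {b' : F} (hb' : b' = (C + a ^ c * D) / b) (hb'0 : b' ≠ 0) (hp : b ^ c * U + V ≠ 0)
    {a' : F} (ha' : a' = w * (U * C ^ c + b' ^ c * V) / a) (ha'0 : a' ≠ 0)
    (h1 : f ∈ Algebra.adjoin A ((R : Set F) ∪ {a, a⁻¹, b, b⁻¹}))
    (h2 : f ∈ Algebra.adjoin A
      ((R : Set F) ∪ {(b ^ c * U + V) / a, ((b ^ c * U + V) / a)⁻¹, b, b⁻¹}))
    (h3 : f ∈ Algebra.adjoin A ((R : Set F) ∪ {a, a⁻¹, b', b'⁻¹})) :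
    f ∈ Algebra.adjoin A ((R : Set F) ∪ {a', a'⁻¹, b', b'⁻¹}) := by
  have ha0 : a ≠ 0 := by
    rintro rfl
    exact ha isAlgebraic_zero
  obtain ⟨e, rfl⟩ : ∃ e, c = e + 1 := Nat.exists_eq_add_one_of_ne_zero hc
  set c := e + 1 with hcdef
  set a₁ := (b ^ c * U + V) / a with ha₁
  -- The one-variable lemma in `a`, over R[b, b⁻¹].
  have hf : f ∈ Algebra.adjoin A ((R : Set F) ∪ {a, a₁, b, b⁻¹}) := by
    let R₁ := Algebra.adjoin A ((R : Set F) ∪ {b, b⁻¹})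
    have hR₁ : ∀ r ∈ R, r ∈ R₁ := fun r hr => Algebra.subset_adjoin (Or.inl hr)
    have hbR₁ : b ∈ R₁ := Algebra.subset_adjoin (by simp)
    have hbR₁' : b⁻¹ ∈ R₁ := Algebra.subset_adjoin (by simp)
    have hE₁ : ∀ r ∈ R₁, r ∈ E := by
      intro r hr
      induction hr using Algebra.adjoin_induction with
      | mem s hs =>
        rcases hs with hs | hs | hs
        · exact hE s hs
        · exact hs ▸ hb
        · rw [Set.mem_singleton_iff.mp hs]
          exact E.inv_mem hb
      | algebraMap r => exact hE _ (R.algebraMap_mem r)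
      | add u v _ _ hu hv => exact E.add_mem hu hv
      | mul u v _ _ hu hv => exact E.mul_mem hu hv
    have hle : ∀ t s : F, Algebra.adjoin A ((R : Set F) ∪ {t, s, b, b⁻¹}) ≤
        Algebra.adjoin A ((R₁ : Set F) ∪ {t, s}) := by
      intro t s
      refine Algebra.adjoin_le ?_
      rintro x (hx | hx | hx | hx | hx)
      · exact Algebra.subset_adjoin (Or.inl (hR₁ x hx))
      · exact Algebra.subset_adjoin (by simp [hx])
      · exact Algebra.subset_adjoin (by rw [hx]; simp)
      · exact Algebra.subset_adjoin (Or.inl (hx ▸ hbR₁))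
      · exact Algebra.subset_adjoin (Or.inl (Set.mem_singleton_iff.mp hx ▸ hbR₁'))
    have := mem_adjoin_pair_of_mem_laurent R₁ E hE₁ ha
      (R₁.add_mem (R₁.mul_mem (R₁.pow_mem hbR₁ c) (hR₁ _ hU)) (hR₁ _ hV)) hp
      (hle _ _ h1) (hle _ _ h2)
    refine Algebra.adjoin_le ?_ this
    rintro x (hx | hx)
    · exact Algebra.adjoin_mono (by
        rintro y (hy | hy | hy)
        · exact Or.inl hy
        · simp [hy]
        · rw [Set.mem_singleton_iff.mp hy]; simp) hx
    · exact Algebra.subset_adjoin (Or.inr (by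
        rcases hx with hx | hx
        · simp [hx]
        · rw [Set.mem_singleton_iff.mp hx]; simp [ha₁]))
  -- Since a = w (U C ^ c + b' ^ c V) / a', this ring lies in the target, so f ∈ W suffices. That is
  -- tested after inverting g = b b' and after inverting `a`.
  let W := Algebra.adjoin A ((R : Set F) ∪ {a, a', b', b'⁻¹})
  have hRW : ∀ r ∈ R, r ∈ W := fun r hr => Algebra.subset_adjoin (Or.inl hr)
  have haW : a ∈ W := Algebra.subset_adjoin (by simp)
  have ha'W : a' ∈ W := Algebra.subset_adjoin (by simp)
  have hb'W : b' ∈ W := Algebra.subset_adjoin (by simp)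
  have hbi'W : b'⁻¹ ∈ W := Algebra.subset_adjoin (by simp)
  set g := C + a ^ c * D with hg
  have hgW : g ∈ W := W.add_mem (hRW _ hC) (W.mul_mem (W.pow_mem haW c) (hRW _ hD))
  have hgb : g = b' * b := by rw [hb', div_mul_cancel₀ _ hb0]
  -- Modulo `a` the element `g` is `C`. This congruence lets `a` be divided out of b ^ c U + V and
  -- expresses `a₁` through a'.
  obtain ⟨q, hqW, hq⟩ : ∃ q ∈ W, g ^ c = C ^ c + a * q := by
    obtain ⟨q, hq⟩ := sub_dvd_pow_sub_pow (⟨g, hgW⟩ : W) ⟨C, hRW _ hC⟩ c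
    have hq' : g ^ c - C ^ c = (g - C) * q := congrArg Subtype.val hq
    refine ⟨a ^ e * D * q, W.mul_mem (W.mul_mem (W.pow_mem haW e) (hRW _ hD)) q.2, ?_⟩
    rw [sub_eq_iff_eq_add] at hq'
    rw [hq', hg, hcdef]
    ring
  have ha₁W : a₁ = b'⁻¹ ^ c * (w⁻¹ * a' + q * U) := by
    have e1 : b ^ c = b'⁻¹ ^ c * (C ^ c + a * q) := by
      rw [← hq, hgb, mul_pow, ← mul_assoc, ← mul_pow, inv_mul_cancel₀ hb'0, one_pow, one_mul]
    have e2 : b'⁻¹ ^ c * b' ^ c = 1 := by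
      rw [← mul_pow, inv_mul_cancel₀ hb'0, one_pow]
    rw [ha₁, ha', e1, div_eq_iff ha0]
    have e3 : w⁻¹ * (w * (U * C ^ c + b' ^ c * V) / a) * a = U * C ^ c + b' ^ c * V := by
      field_simp
    linear_combination (-b'⁻¹ ^ c) * e3 - V * e2
  obtain ⟨N, hN⟩ : ∃ N : ℕ, g ^ N * f ∈ W := by
    refine exists_pow_mul_mem_of_mem_adjoin W hgW ?_ hf
    rintro s (hs | rfl | rfl | rfl | hs)
    · exact ⟨0, by simpa using hRW s hs⟩
    · exact ⟨0, by simpa using haW⟩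
    · refine ⟨0, ?_⟩
      rw [pow_zero, one_mul, ha₁W]
      exact W.mul_mem (W.pow_mem hbi'W c)
        (W.add_mem (W.mul_mem (hRW _ hw') ha'W) (W.mul_mem hqW (hRW _ hU)))
    · refine ⟨0, ?_⟩
      have : s = b'⁻¹ * g := by rw [hgb, inv_mul_cancel_left₀ hb'0]
      rw [pow_zero, one_mul, this]
      exact W.mul_mem hbi'W hgW
    · refine ⟨1, ?_⟩
      rw [Set.mem_singleton_iff.mp hs, pow_one, hgb, mul_inv_cancel_right₀ hb0]
      exact hb'W
  obtain ⟨M, hM⟩ : ∃ M : ℕ, a ^ M * f ∈ W := by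
    refine exists_pow_mul_mem_of_mem_adjoin W haW ?_ h3
    rintro s (hs | hs | hs | hs | hs)
    · exact ⟨0, by simpa using hRW s hs⟩
    · exact ⟨0, by simpa [hs] using haW⟩
    · exact ⟨1, by rw [hs, pow_one, mul_inv_cancel₀ ha0]; exact W.one_mem⟩
    · exact ⟨0, by simpa [hs] using hb'W⟩
    · exact ⟨0, by rw [Set.mem_singleton_iff.mp hs]; simpa using hbi'W⟩
  -- As c ≥ 1 and C is a unit of `R`, C⁻¹ g - (C⁻¹ a ^ (c - 1) D) a = 1.
  have hfW : f ∈ W := by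
    refine mem_of_comaximal W hgW haW (hRW _ hC')
      (W.neg_mem (W.mul_mem (hRW _ hC') (W.mul_mem (W.pow_mem haW e) (hRW _ hD)))) ?_ hN hM
    rw [hg, hcdef]
    field_simp
    ring
  refine Algebra.adjoin_le ?_ hfW
  have hRT : ∀ r ∈ R, r ∈ Algebra.adjoin A ((R : Set F) ∪ {a', a'⁻¹, b', b'⁻¹}) :=
    fun r hr => Algebra.subset_adjoin (Or.inl hr)
  have hb'T : b' ∈ Algebra.adjoin A ((R : Set F) ∪ {a', a'⁻¹, b', b'⁻¹}) :=
    Algebra.subset_adjoin (by simp)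
  rintro s (hs | hs | hs | hs | hs)
  · exact hRT s hs
  · have : a = w * (U * C ^ c + b' ^ c * V) * a'⁻¹ := by
      rw [eq_mul_inv_iff_mul_eq₀ ha'0, ha', mul_div_cancel₀ _ ha0]
    rw [hs]
    have h := Subalgebra.mul_mem _ (Subalgebra.mul_mem _ (hRT _ hw)
      (Subalgebra.add_mem _ (Subalgebra.mul_mem _ (hRT _ hU) (Subalgebra.pow_mem _ (hRT _ hC) c))
        (Subalgebra.mul_mem _ (Subalgebra.pow_mem _ hb'T c) (hRT _ hV))))
      (Algebra.subset_adjoin (show a'⁻¹ ∈ (R : Set F) ∪ {a', a'⁻¹, b', b'⁻¹} by simp))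
    rwa [← this] at h
  · exact Algebra.subset_adjoin (by rw [hs]; simp)
  · exact Algebra.subset_adjoin (by rw [hs]; simp)
  · exact Algebra.subset_adjoin (by rw [Set.mem_singleton_iff.mp hs]; simp)

end RankTwo

/-! ### Algebraic independence under an exchange. -/

section Independence

theorem AlgebraicIndependent.transcendental_adjoin_compl {k K ι : Type*} [Field k] [Field K]
    [Algebra k K] {x : ι → K} (hx : AlgebraicIndependent k x) (j : ι) :
    Transcendental (IntermediateField.adjoin k (x '' {j}ᶜ)) (x j) :=
  IntermediateField.transcendental_adjoin_iff.mpr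
    ((AlgebraicIndependent.iff_transcendental_adjoin_image j).mp hx).2

/-- If P / x_j were algebraic over the field generated by the other variables, so would be x_j = P
(P / x_j)⁻¹. -/
theorem AlgebraicIndependent.update_div {k K ι : Type*} [Field k] [Field K] [DecidableEq ι]
    [Algebra k K] {x : ι → K} (hx : AlgebraicIndependent k x) (j : ι) {P : K}
    (hP : P ∈ IntermediateField.adjoin k (x '' {j}ᶜ)) (hP0 : P ≠ 0) :
    AlgebraicIndependent k (Function.update x j (P / x j)) := by
  have himg : Function.update x j (P / x j) '' {j}ᶜ = x '' {j}ᶜ :=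
    Set.image_congr fun i hi => Function.update_of_ne hi _ _
  refine (AlgebraicIndependent.iff_transcendental_adjoin_image j).mpr ⟨?_, ?_⟩
  · convert ((AlgebraicIndependent.iff_transcendental_adjoin_image j).mp hx).1 using 2 with i
    exact Function.update_of_ne i.2 _ _
  · rw [himg, Function.update_self, ← IntermediateField.transcendental_adjoin_iff]
    intro h
    apply AlgebraicIndependent.transcendental_adjoin_compl hx j
    have h2 := (isAlgebraic_algebraMap
      (⟨P, hP⟩ : IntermediateField.adjoin k (x '' {j}ᶜ)) (A := K)).mul h.inv
    have e : (algebraMap (IntermediateField.adjoin k (x '' {j}ᶜ)) K) ⟨P, hP⟩ * (P / x j)⁻¹ =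
        x j := by
      change P * (P / x j)⁻¹ = x j
      rw [inv_div, mul_div_cancel₀ _ hP0]
    rwa [e] at h2

end Independence

end ClusterAlg
namespace ClusterAlg

/-! ### Laurent polynomial rings and regular sequences of binomials. -/

section LaurentRing

variable {ι : Type*}

/-- The ring of integral Laurent polynomials in variables indexed by `ι`. -/
abbrev LaurentRing (ι : Type*) : Type _ := AddMonoidAlgebra ℤ (ι → ℤ)

namespace LaurentRing

/-- The ring homomorphism to Laurent polynomials in one variable over `S` which is `h` on
coefficients and records the degree with respect to `φ`. -/
noncomputable def gradingHom {S : Type*} [CommRing S] (h : LaurentRing ι →+* S)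
    (φ : (ι → ℤ) →+ ℤ) : LaurentRing ι →ₐ[ℤ] LaurentPolynomial S :=
  AddMonoidAlgebra.lift ℤ (LaurentPolynomial S) (ι → ℤ)
    { toFun := fun a => LaurentPolynomial.C (h (AddMonoidAlgebra.single a.toAdd 1)) *
        LaurentPolynomial.T (φ a.toAdd)
      map_one' := by
        rw [toAdd_one, map_zero, LaurentPolynomial.T_zero, mul_one,
          ← AddMonoidAlgebra.one_def, map_one, map_one]
      map_mul' := fun a b => by
        rw [toAdd_mul, map_add, LaurentPolynomial.T_add,
          show AddMonoidAlgebra.single (a.toAdd + b.toAdd) (1 : ℤ) =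
            AddMonoidAlgebra.single a.toAdd 1 * AddMonoidAlgebra.single b.toAdd 1 by
            rw [AddMonoidAlgebra.single_mul_single, one_mul], map_mul, map_mul]
        ring }

theorem gradingHom_single {S : Type*} [CommRing S] (h : LaurentRing ι →+* S)
    (φ : (ι → ℤ) →+ ℤ) (a : ι → ℤ) (c : ℤ) :
    gradingHom h φ (AddMonoidAlgebra.single a c) =
      c • (LaurentPolynomial.C (h (AddMonoidAlgebra.single a 1)) * LaurentPolynomial.T (φ a)) :=
  AddMonoidAlgebra.lift_single _ _ _

theorem eval_one_gradingHom {S : Type*} [CommRing S] (h : LaurentRing ι →+* S)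
    (φ : (ι → ℤ) →+ ℤ) (f : LaurentRing ι) :
    LaurentPolynomial.eval₂ (RingHom.id S) 1 (gradingHom h φ f) = h f := by
  induction f using AddMonoidAlgebra.induction_linear with
  | zero => simp
  | add f g hf hg => rw [map_add, map_add, map_add, hf, hg]
  | single a c =>
    rw [gradingHom_single, map_zsmul, map_mul, LaurentPolynomial.eval₂_C,
      LaurentPolynomial.eval₂_T, one_zpow, Units.val_one, mul_one, RingHom.id_apply, ← map_zsmul,
      AddMonoidAlgebra.smul_single, smul_eq_mul, mul_one]

/-- The lowest coefficient of `g`, times the unit in the lower term of the binomial, is the lowest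
coefficient of the product. Only unit coefficients are needed: `S` may have zero divisors, as a
quotient by a binomial can. -/
theorem eq_zero_of_binomial_mul_eq_zero {S : Type*} [CommRing S] {u v : S} (hu : IsUnit u)
    (hv : IsUnit v) {m n : ℤ} (hmn : m ≠ n) {g : LaurentPolynomial S}
    (h : (LaurentPolynomial.C u * LaurentPolynomial.T m +
      LaurentPolynomial.C v * LaurentPolynomial.T n) * g = 0) : g = 0 := by
  wlog hlt : m < n generalizing u v m n
  · exact this hv hu hmn.symm (by rwa [add_comm]) (lt_of_le_of_ne (not_lt.mp hlt) hmn.symm)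
  by_contra hg
  have hs : g.coeff.support.Nonempty := by
    rw [Finsupp.support_nonempty_iff]
    exact fun h => hg (AddMonoidAlgebra.coeff_eq_zero.mp h)
  set N := g.coeff.support.min' hs with hN
  have hN1 : g.coeff N ≠ 0 := Finsupp.mem_support_iff.mp (Finset.min'_mem _ hs)
  have hN2 : g.coeff (N + m - n) = 0 := by
    by_contra hne
    have := Finset.min'_le _ _ (Finsupp.mem_support_iff.mpr hne)
    rw [← hN] at this
    omega
  have h1 := congrArg (fun p : LaurentPolynomial S => p.coeff (N + m)) h
  simp only [← LaurentPolynomial.single_eq_C_mul_T, add_mul, AddMonoidAlgebra.coeff_add,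
    Finsupp.add_apply, AddMonoidAlgebra.coeff_single_mul_apply] at h1
  rw [show -m + (N + m) = N by ring, show -n + (N + m) = N + m - n by ring, hN2] at h1
  simp only [mul_zero, add_zero, AddMonoidAlgebra.coeff_zero, Finsupp.zero_apply] at h1
  exact hN1 (hu.mul_right_eq_zero.mp h1)

theorem isUnit_single (a : ι → ℤ) : IsUnit (AddMonoidAlgebra.single a 1 : LaurentRing ι) :=
  IsUnit.of_mul_eq_one (AddMonoidAlgebra.single (-a) 1) (by
    rw [AddMonoidAlgebra.single_mul_single, add_neg_cancel, one_mul, AddMonoidAlgebra.one_def])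

/-- Two binomials with linearly independent exponent differences form a regular sequence. -/
theorem dvd_of_binomial_dvd_mul {a b a' b' : ι → ℤ} (φ : (ι → ℤ) →+ ℤ) (h0 : φ a = φ b)
    (h1 : φ a' ≠ φ b') {G : LaurentRing ι}
    (h : (AddMonoidAlgebra.single a 1 + AddMonoidAlgebra.single b 1 : LaurentRing ι) ∣
      (AddMonoidAlgebra.single a' 1 + AddMonoidAlgebra.single b' 1) * G) :
    (AddMonoidAlgebra.single a 1 + AddMonoidAlgebra.single b 1 : LaurentRing ι) ∣ G := by
  set r : LaurentRing ι := AddMonoidAlgebra.single a 1 + AddMonoidAlgebra.single b 1 with hr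
  let q := Ideal.Quotient.mk (Ideal.span {r})
  have hq : ∀ f, q f = 0 ↔ r ∣ f := fun f => by
    rw [Ideal.Quotient.eq_zero_iff_mem, Ideal.mem_span_singleton]
  -- By `h0` the binomial `r` is homogeneous for `φ`, so the grading map with coefficients modulo
  -- `r` kills it. The other binomial keeps two distinct degrees with unit coefficients, hence is a
  -- nonzerodivisor there, and the image of G vanishes; setting T = 1 gives divisibility.
  have hr0 : gradingHom q φ (AddMonoidAlgebra.single a 1 + AddMonoidAlgebra.single b 1) = 0 := by
    rw [map_add, gradingHom_single, gradingHom_single, h0, one_smul, one_smul, ← add_mul,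
      ← map_add, ← map_add, (hq _).mpr dvd_rfl, map_zero, zero_mul]
  replace hr0 : gradingHom q φ r = 0 := hr0
  obtain ⟨H, hH⟩ := h
  have h2 := congrArg (gradingHom q φ) hH
  rw [map_mul, map_mul, hr0, zero_mul, map_add, gradingHom_single, gradingHom_single, one_smul,
    one_smul] at h2
  have h3 := eq_zero_of_binomial_mul_eq_zero ((isUnit_single a').map q) ((isUnit_single b').map q)
    h1 h2
  rw [← hq, ← eval_one_gradingHom q φ, h3, map_zero]

variable [Fintype ι]

/-- Evaluation of Laurent polynomials at units. -/
noncomputable def eval {S : Type*} [CommRing S] (u : ι → Sˣ) : LaurentRing ι →ₐ[ℤ] S :=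
  AddMonoidAlgebra.lift ℤ S (ι → ℤ)
    { toFun := fun a => ((∏ i, u i ^ (a.toAdd i) : Sˣ) : S)
      map_one' := by simp
      map_mul' := fun a b => by
        rw [← Units.val_mul, ← Finset.prod_mul_distrib]
        simp [zpow_add] }

theorem eval_single {S : Type*} [CommRing S] (u : ι → Sˣ) (a : ι → ℤ) (c : ℤ) :
    eval u (AddMonoidAlgebra.single a c) = c • ((∏ i, u i ^ a i : Sˣ) : S) :=
  AddMonoidAlgebra.lift_single _ _ _

theorem eval_single_natCast {S : Type*} [CommRing S] (u : ι → Sˣ) (a : ι → ℕ) :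
    eval u (AddMonoidAlgebra.single (fun i => (a i : ℤ)) 1) = ∏ i, (u i : S) ^ a i := by
  rw [eval_single, one_smul, Units.coe_prod]
  simp

theorem eval_single_piSingle [DecidableEq ι] {S : Type*} [CommRing S] (u : ι → Sˣ) (i : ι)
    (n : ℤ) : eval u (AddMonoidAlgebra.single (Pi.single i n) 1) = ((u i ^ n : Sˣ) : S) := by
  rw [eval_single, one_smul, Finset.prod_eq_single i]
  · simp
  · intro j _ hj
    simp [hj]
  · simp

/-- A common denominator for a Laurent polynomial. -/
theorem exists_mul_single_eq_aeval [DecidableEq ι] (f : LaurentRing ι) :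
    ∃ (e : ι → ℕ) (g : MvPolynomial ι ℤ),
      f * AddMonoidAlgebra.single (fun i => (e i : ℤ)) 1 =
        MvPolynomial.aeval (fun i => (AddMonoidAlgebra.single (Pi.single i 1) 1 : LaurentRing ι))
          g := by
  have hmon : ∀ e : ι → ℕ, (AddMonoidAlgebra.single (fun i => (e i : ℤ)) 1 : LaurentRing ι) =
      MvPolynomial.aeval (fun i => (AddMonoidAlgebra.single (Pi.single i 1) 1 : LaurentRing ι))
        (∏ i, MvPolynomial.X i ^ e i : MvPolynomial ι ℤ) := by
    intro e
    rw [map_prod]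
    simp only [map_pow, MvPolynomial.aeval_X, AddMonoidAlgebra.single_pow, one_pow]
    rw [AddMonoidAlgebra.prod_single, Finset.prod_const_one]
    congr 1
    funext i
    simp [Finset.sum_apply, Pi.single_apply]
  induction f using AddMonoidAlgebra.induction_linear with
  | zero => exact ⟨0, 0, by simp⟩
  | add f f' hf hf' =>
    obtain ⟨e, g, h⟩ := hf
    obtain ⟨e', g', h'⟩ := hf'
    refine ⟨e + e', g * (∏ i, MvPolynomial.X i ^ e' i) + g' * (∏ i, MvPolynomial.X i ^ e i), ?_⟩
    have : (AddMonoidAlgebra.single (fun i => (((e + e') i : ℕ) : ℤ)) 1 : LaurentRing ι) =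
        AddMonoidAlgebra.single (fun i => (e i : ℤ)) 1 *
          AddMonoidAlgebra.single (fun i => (e' i : ℤ)) 1 := by
      rw [AddMonoidAlgebra.single_mul_single, one_mul]
      rfl
    rw [map_add, map_mul, map_mul, ← hmon, ← hmon, ← h, ← h', this]
    ring
  | single a c =>
    refine ⟨fun i => (-a i).toNat, MvPolynomial.C c * ∏ i, MvPolynomial.X i ^ (a i).toNat, ?_⟩
    rw [map_mul, ← hmon, MvPolynomial.aeval_C, AddMonoidAlgebra.single_mul_single,
      ← Algebra.smul_def, AddMonoidAlgebra.smul_single, smul_eq_mul]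
    congr 1
    funext i
    simp only [Pi.add_apply]
    omega

end LaurentRing

variable {K : Type*} [Field K]

/-- The ring generated by a cluster and the inverses of its elements. -/
noncomputable def laurentAlg (x : ι → K) : Subalgebra ℤ K :=
  Algebra.adjoin ℤ (Set.range x ∪ Set.range fun i => (x i)⁻¹)

theorem mem_laurentAlg (x : ι → K) (i : ι) : x i ∈ laurentAlg x :=
  Algebra.subset_adjoin (Or.inl ⟨i, rfl⟩)

theorem inv_mem_laurentAlg (x : ι → K) (i : ι) : (x i)⁻¹ ∈ laurentAlg x :=
  Algebra.subset_adjoin (Or.inr ⟨i, rfl⟩)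

theorem zpow_mem_of_inv_mem {A F : Type*} [CommRing A] [Field F] [Algebra A F]
    {W : Subalgebra A F} {x : F} (h : x ∈ W) (h' : x⁻¹ ∈ W) (n : ℤ) : x ^ n ∈ W := by
  rcases Int.eq_nat_or_neg n with ⟨n, rfl | rfl⟩
  · rw [zpow_natCast]
    exact W.pow_mem h n
  · rw [zpow_neg, zpow_natCast, ← inv_pow]
    exact W.pow_mem h' n

variable [Fintype ι]

theorem exists_eval_eq_of_mem_laurentAlg {x : ι → K} (hx : ∀ i, x i ≠ 0) {f : K}
    (hf : f ∈ laurentAlg x) :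
    ∃ g : LaurentRing ι, LaurentRing.eval (fun i => Units.mk0 (x i) (hx i)) g = f := by
  classical
  have hle : laurentAlg x ≤ (LaurentRing.eval fun i => Units.mk0 (x i) (hx i)).range := by
    refine Algebra.adjoin_le ?_
    rintro _ (⟨i, rfl⟩ | ⟨i, rfl⟩)
    · exact ⟨AddMonoidAlgebra.single (Pi.single i 1) 1, by
        simp [LaurentRing.eval_single_piSingle]⟩
    · exact ⟨AddMonoidAlgebra.single (Pi.single i (-1)) 1, by
        simp [LaurentRing.eval_single_piSingle]⟩
  exact hle hf

theorem eval_mem_laurentAlg {x : ι → K} (hx : ∀ i, x i ≠ 0) (g : LaurentRing ι) :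
    LaurentRing.eval (fun i => Units.mk0 (x i) (hx i)) g ∈ laurentAlg x := by
  induction g using AddMonoidAlgebra.induction_linear with
  | zero => rw [map_zero]; exact Subalgebra.zero_mem _
  | add f g hf hg => rw [map_add]; exact Subalgebra.add_mem _ hf hg
  | single a c =>
    rw [LaurentRing.eval_single, Units.coe_prod]
    refine Subalgebra.zsmul_mem _ (Subalgebra.prod_mem _ fun i _ => ?_) c
    rw [Units.val_zpow_eq_zpow_val, Units.val_mk0]
    exact zpow_mem_of_inv_mem (mem_laurentAlg x i) (inv_mem_laurentAlg x i) _

theorem eval_injective {x : ι → K} (hx : ∀ i, x i ≠ 0) (hind : AlgebraicIndependent ℤ x) :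
    Function.Injective (LaurentRing.eval fun i => Units.mk0 (x i) (hx i)) := by
  classical
  rw [injective_iff_map_eq_zero]
  intro f hf
  obtain ⟨e, g, h⟩ := LaurentRing.exists_mul_single_eq_aeval f
  have h2 := congrArg (LaurentRing.eval fun i => Units.mk0 (x i) (hx i)) h
  rw [map_mul, hf, zero_mul, MvPolynomial.comp_aeval_apply] at h2
  simp only [LaurentRing.eval_single_piSingle, zpow_one, Units.val_mk0] at h2
  rw [(algebraicIndependent_iff.mp hind) g h2.symm, map_zero] at h
  exact (LaurentRing.isUnit_single _).mul_left_eq_zero.mp h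

end LaurentRing

end ClusterAlg
namespace ClusterAlg

/-! ### Mutation of exchange matrices. -/

section MatrixMutation

/-- Trades the exact halving for products of positive and negative parts, on which ring identities
apply. -/
theorem half_abs_mul_add (a b : ℤ) :
    (|a| * b + a * |b|) / 2 = max a 0 * max b 0 - max (-a) 0 * max (-b) 0 := by
  rcases le_total 0 a with ha | ha <;> rcases le_total 0 b with hb | hb
  · rw [abs_of_nonneg ha, abs_of_nonneg hb, max_eq_left ha, max_eq_left hb,
      max_eq_right (by omega : -a ≤ 0), ← two_mul, Int.mul_ediv_cancel_left _ two_ne_zero]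
    ring
  · rw [abs_of_nonneg ha, abs_of_nonpos hb, max_eq_right hb, max_eq_right (by omega : -a ≤ 0)]
    simp
  · rw [abs_of_nonpos ha, abs_of_nonneg hb, max_eq_right ha, max_eq_right (by omega : -b ≤ 0)]
    simp
  · rw [abs_of_nonpos ha, abs_of_nonpos hb, max_eq_right ha, max_eq_right hb,
      max_eq_left (by omega : 0 ≤ -a), max_eq_left (by omega : 0 ≤ -b)]
    rw [show -a * b + a * -b = 2 * (-(a * b)) by ring, Int.mul_ediv_cancel_left _ two_ne_zero]
    ring

theorem diag_eq_zero_of_skew {ι : Type*} {B : Matrix ι ι ℤ} (hB : ∀ i j, B i j = -B j i) (i : ι) :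
    B i i = 0 := by
  have := hB i i
  omega

variable {ι : Type*} [DecidableEq ι]

/-- Mutation of an exchange matrix in direction `k`. -/
def matMut (B : Matrix ι ι ℤ) (k : ι) : Matrix ι ι ℤ :=
  fun i j => if i = k ∨ j = k then -B i j
    else B i j + (|B i k| * B k j + B i k * |B k j|) / 2

theorem matMut_matMut (B : Matrix ι ι ℤ) (k : ι) : matMut (matMut B k) k = B := by
  ext i j
  by_cases h : i = k ∨ j = k
  · simp [matMut, h]
  · simp only [matMut, h, if_false, or_true, true_or, if_true]
    rw [half_abs_mul_add, half_abs_mul_add, neg_neg, neg_neg]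
    ring

theorem matMut_neg (B : Matrix ι ι ℤ) (k : ι) : matMut (-B) k = -matMut B k := by
  ext i j
  by_cases h : i = k ∨ j = k
  · simp [matMut, h]
  · simp only [matMut, h, if_false, Matrix.neg_apply]
    rw [half_abs_mul_add, half_abs_mul_add, neg_neg, neg_neg]
    ring

theorem matMut_skew {B : Matrix ι ι ℤ} (hB : ∀ i j, B i j = -B j i) (k i j : ι) :
    matMut B k i j = -matMut B k j i := by
  by_cases h : i = k ∨ j = k
  · simp only [matMut, h, h.symm, if_true]
    rw [hB i j]
  · have h' : ¬ (j = k ∨ i = k) := fun h' => h h'.symm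
    simp only [matMut, h, h', if_false]
    rw [half_abs_mul_add, half_abs_mul_add, hB i j, hB i k, hB k j, neg_neg, neg_neg]
    ring

/-- Columns of vertices not joined to `k` are unchanged. -/
theorem matMut_apply_of_eq_zero {B : Matrix ι ι ℤ} {k j : ι}
    (hj : j ≠ k) (h : B k j = 0) (i : ι) : matMut B k i j = B i j := by
  by_cases hi : i = k
  · subst hi
    simp [matMut, h]
  · simp [matMut, hi, hj, h]

variable [Fintype ι]

/-- Mutation is the congruence E B Eᵀ, where E is the identity with column `k` replaced by `e`; its
determinant is -1. -/
theorem det_matMut_ne_zero {B : Matrix ι ι ℤ} (hB : ∀ i j, B i j = -B j i) (hdet : B.det ≠ 0)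
    (k : ι) : (matMut B k).det ≠ 0 := by
  let e : ι → ℤ := fun i => if i = k then -1 else max (-B i k) 0
  let E : Matrix ι ι ℤ := (1 : Matrix ι ι ℤ).updateCol k e
  have hE : E.det = -1 := by
    rw [← Matrix.cramer_apply, Matrix.cramer_one]
    simp [e]
  have hEapp : ∀ i l, E i l = if l = k then e i else if i = l then 1 else 0 := by
    intro i l
    change (Matrix.updateCol 1 k e) i l = _
    rw [Matrix.updateCol_apply, Matrix.one_apply]
  have hmul : ∀ (M : Matrix ι ι ℤ) i j,
      (E * M) i j = (if i = k then 0 else M i j) + e i * M k j := by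
    intro M i j
    rw [Matrix.mul_apply, ← Finset.add_sum_erase _ _ (Finset.mem_univ k), hEapp, if_pos rfl,
      add_comm]
    congr 1
    by_cases hi : i = k
    · rw [if_pos hi]
      refine Finset.sum_eq_zero fun l hl => ?_
      have hl' := Finset.ne_of_mem_erase hl
      rw [hEapp, if_neg hl', if_neg (by rw [hi]; exact hl'.symm), zero_mul]
    · rw [if_neg hi, Finset.sum_eq_single i]
      · rw [hEapp, if_neg hi, if_pos rfl, one_mul]
      · intro l hl hli
        rw [hEapp, if_neg (Finset.ne_of_mem_erase hl), if_neg hli.symm, zero_mul]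
      · intro h
        exact absurd (Finset.mem_erase.mpr ⟨hi, Finset.mem_univ i⟩) h
  have hkk := diag_eq_zero_of_skew hB k
  have hfac : matMut B k = E * (E * B.transpose).transpose := by
    ext i j
    rw [hmul, Matrix.transpose_apply, Matrix.transpose_apply, hmul, hmul]
    simp only [Matrix.transpose_apply, e, matMut]
    rw [half_abs_mul_add]
    by_cases hi : i = k <;> by_cases hj : j = k
    · subst hi; subst hj; simp [hkk]
    · subst hi; simp [hj, hkk]
    · subst hj; simp [hi, hkk]
    · simp only [hi, hj, if_false, or_self]
      rw [hB j k, neg_neg]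
      rcases le_total 0 (B i k) with h1 | h1 <;> rcases le_total 0 (B k j) with h2 | h2
      all_goals simp [h1, h2, hkk]
      all_goals ring
  rw [hfac, Matrix.det_mul, Matrix.det_transpose, Matrix.det_mul, Matrix.det_transpose, hE]
  simpa using hdet

end MatrixMutation

section Independence

variable {ι : Type*} [Fintype ι]

/-- The hypothesis on p + q covers the case in which the two monomials coincide. -/
theorem AlgebraicIndependent.binomial_ne_zero {k K : Type*} [Field k] [Field K] [Algebra k K]
    {x : ι → K} (hx : AlgebraicIndependent k x) {p q : k} (hp : p ≠ 0) (hpq : p + q ≠ 0)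
    (a b : ι → ℕ) : algebraMap k K p * ∏ i, x i ^ a i + algebraMap k K q * ∏ i, x i ^ b i ≠ 0 := by
  classical
  intro h
  let a' : ι →₀ ℕ := Finsupp.equivFunOnFinite.symm a
  let b' : ι →₀ ℕ := Finsupp.equivFunOnFinite.symm b
  have hmon : ∀ (c : ι → ℕ) (r : k), MvPolynomial.aeval x
      (MvPolynomial.monomial (Finsupp.equivFunOnFinite.symm c) r) =
      algebraMap k K r * ∏ i, x i ^ c i := by
    intro c r
    rw [MvPolynomial.aeval_monomial, Finsupp.prod_fintype _ _ (fun i => pow_zero _)]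
    rfl
  have h1 : MvPolynomial.aeval x
      (MvPolynomial.monomial a' p + MvPolynomial.monomial b' q) = 0 := by
    rw [map_add, hmon, hmon, h]
  have h2 := congrArg (MvPolynomial.coeff a') (algebraicIndependent_iff.mp hx _ h1)
  rw [MvPolynomial.coeff_add, MvPolynomial.coeff_monomial, MvPolynomial.coeff_monomial,
    if_pos rfl, MvPolynomial.coeff_zero] at h2
  split_ifs at h2
  · exact hpq h2
  · exact hp (by simpa using h2)

theorem prod_pow_mem_adjoin_compl {k K : Type*} [Field k] [Field K] [Algebra k K] (x : ι → K)
    (j : ι) {a : ι → ℕ} (ha : a j = 0) :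
    ∏ i, x i ^ a i ∈ IntermediateField.adjoin k (x '' {j}ᶜ) := by
  refine prod_mem fun i _ => ?_
  by_cases hi : i = j
  · rw [hi, ha, pow_zero]
    exact one_mem _
  · exact pow_mem (IntermediateField.subset_adjoin k _ (Set.mem_image_of_mem x hi)) _

end Independence

/-! ### Exchange binomials and mutation of clusters. -/

section Exchange

variable {ι : Type*} [Fintype ι] {K : Type*} [CommRing K]

/-- The exchange binomial in direction `k`. -/
def exch (B : Matrix ι ι ℤ) (x : ι → K) (k : ι) : K :=
  ∏ i, x i ^ (B i k).toNat + ∏ i, x i ^ (-B i k).toNat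

theorem exch_neg (B : Matrix ι ι ℤ) (x : ι → K) (k : ι) : exch (-B) x k = exch B x k := by
  simp only [exch, Matrix.neg_apply, neg_neg]
  rw [add_comm]

theorem exch_congr {B B' : Matrix ι ι ℤ} {x x' : ι → K} {k : ι} (hB : ∀ i, B i k = B' i k)
    (hx : ∀ i, B i k ≠ 0 → x i = x' i) : exch B x k = exch B' x' k := by
  have : ∀ (m : ℤ → ℕ), m 0 = 0 → ∏ i, x i ^ m (B i k) = ∏ i, x' i ^ m (B' i k) := by
    intro m hm
    refine Finset.prod_congr rfl fun i _ => ?_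
    rw [← hB]
    by_cases h : B i k = 0
    · rw [h, hm, pow_zero, pow_zero]
    · rw [hx i h]
  rw [exch, exch, this Int.toNat rfl, this (fun b => (-b).toNat) rfl]

theorem map_exch {R S : Type*} [CommRing R] [CommRing S] (f : R →+* S) (B : Matrix ι ι ℤ)
    (x : ι → R) (k : ι) : f (exch B x k) = exch B (fun i => f (x i)) k := by
  simp [exch]

end Exchange

section ClusterMutation

variable {ι : Type*} [Fintype ι] {K : Type*} [Field K]

variable [DecidableEq ι]

/-- Mutation of a cluster in direction `k`. -/
def clMut (B : Matrix ι ι ℤ) (x : ι → K) (k : ι) : ι → K :=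
  Function.update x k (exch B x k / x k)

theorem clMut_neg (B : Matrix ι ι ℤ) (x : ι → K) (k : ι) : clMut (-B) x k = clMut B x k := by
  rw [clMut, clMut, exch_neg]

theorem clMut_self (B : Matrix ι ι ℤ) (x : ι → K) (k : ι) :
    clMut B x k k = exch B x k / x k :=
  Function.update_self ..

theorem clMut_of_ne (B : Matrix ι ι ℤ) (x : ι → K) {k i : ι} (h : i ≠ k) :
    clMut B x k i = x i :=
  Function.update_of_ne h ..

/-- Mutation at `k` only negates column `k`, and the binomial does not involve x_k because the
diagonal entry is 0. -/
theorem exch_matMut_clMut {B : Matrix ι ι ℤ} (hB : ∀ i j, B i j = -B j i) (x : ι → K) (k : ι) :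
    exch (matMut B k) (clMut B x k) k = exch B x k := by
  rw [← exch_neg B x k]
  refine exch_congr (fun i => by simp [matMut]) fun i hi => clMut_of_ne _ _ ?_
  rintro rfl
  rw [diag_eq_zero_of_skew (matMut_skew hB i)] at hi
  exact hi rfl

theorem clMut_clMut {B : Matrix ι ι ℤ} (hB : ∀ i j, B i j = -B j i) {x : ι → K} {k : ι}
    (he : exch B x k ≠ 0) : clMut (matMut B k) (clMut B x k) k = x := by
  rw [clMut, exch_matMut_clMut hB, clMut_self, clMut, Function.update_idem]
  rw [div_div_cancel₀ he]
  exact Function.update_eq_self k x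

/-- A cluster of algebraically independent elements together with a nondegenerate skew-symmetric
exchange matrix. -/
structure IsNondegSeed [Algebra ℚ K] (B : Matrix ι ι ℤ) (x : ι → K) : Prop where
  skew : ∀ i j, B i j = -B j i
  det_ne_zero : B.det ≠ 0
  indep : AlgebraicIndependent ℚ x

namespace IsNondegSeed

variable [Algebra ℚ K] {B : Matrix ι ι ℤ} {x : ι → K}

theorem ne_zero (h : IsNondegSeed B x) (i : ι) : x i ≠ 0 := h.indep.ne_zero i

theorem exch_ne_zero (h : IsNondegSeed B x) (k : ι) : exch B x k ≠ 0 := by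
  have := AlgebraicIndependent.binomial_ne_zero h.indep one_ne_zero
    (show (1 : ℚ) + 1 ≠ 0 by norm_num) (fun i => (B i k).toNat) fun i => (-B i k).toNat
  rwa [map_one, one_mul, one_mul] at this

theorem mutate (h : IsNondegSeed B x) (k : ι) : IsNondegSeed (matMut B k) (clMut B x k) where
  skew := matMut_skew h.skew k
  det_ne_zero := det_matMut_ne_zero h.skew h.det_ne_zero k
  indep := by
    have hkk := diag_eq_zero_of_skew h.skew k
    exact AlgebraicIndependent.update_div h.indep k
      (add_mem (prod_pow_mem_adjoin_compl x k (by simp [hkk]))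
        (prod_pow_mem_adjoin_compl x k (by simp [hkk]))) (h.exch_ne_zero k)

theorem neg (h : IsNondegSeed B x) : IsNondegSeed (-B) x where
  skew := fun i j => by simp [h.skew i j]
  det_ne_zero := by
    rw [Matrix.det_neg]
    exact mul_ne_zero (pow_ne_zero _ (by norm_num)) h.det_ne_zero
  indep := h.indep

theorem clMut_clMut (h : IsNondegSeed B x) (k : ι) :
    clMut (matMut B k) (clMut B x k) k = x :=
  ClusterAlg.clMut_clMut h.skew (h.exch_ne_zero k)

theorem eval_injective (h : IsNondegSeed B x) :
    Function.Injective (LaurentRing.eval fun i => Units.mk0 (x i) (h.ne_zero i)) :=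
  ClusterAlg.eval_injective h.ne_zero (h.indep.restrictScalars (algebraMap ℤ ℚ).injective_int)

/-- The regularity of exchange binomials in two different directions. -/
theorem exch_regular (h : IsNondegSeed B x) {j k : ι} (hjk : j ≠ k) {G H : K}
    (hG : G ∈ laurentAlg x) (hH : H ∈ laurentAlg x) (hGH : exch B x j * G = exch B x k * H) :
    ∃ H' ∈ laurentAlg x, G = exch B x k * H' := by
  have hx := h.ne_zero
  have hinj := h.eval_injective
  have hexch : ∀ l, exch B x l = LaurentRing.eval (fun i => Units.mk0 (x i) (hx i))
      (AddMonoidAlgebra.single (fun i => ((B i l).toNat : ℤ)) 1 +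
        AddMonoidAlgebra.single (fun i => ((-B i l).toNat : ℤ)) 1) := by
    intro l
    rw [map_add, LaurentRing.eval_single_natCast, LaurentRing.eval_single_natCast]
    rfl
  obtain ⟨G, rfl⟩ := exists_eval_eq_of_mem_laurentAlg hx hG
  obtain ⟨H, rfl⟩ := exists_eval_eq_of_mem_laurentAlg hx hH
  rw [hexch, hexch, ← map_mul, ← map_mul] at hGH
  -- Pairing with row `j` of the adjugate sends column `j` of B to det B and every other column to
  -- 0. So the exponents of the binomial at `k` have equal degree and those of the binomial at `j`
  -- do not.
  let φ : (ι → ℤ) →+ ℤ :=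
    { toFun := fun a => ∑ i, B.adjugate j i * a i
      map_zero' := by simp
      map_add' := fun a b => by simp [mul_add, Finset.sum_add_distrib] }
  have hφ : ∀ l, φ (fun i => ((B i l).toNat : ℤ)) - φ (fun i => ((-B i l).toNat : ℤ)) =
      if j = l then B.det else 0 := by
    intro l
    rw [← map_sub]
    have : (fun i => ((B i l).toNat : ℤ)) - (fun i => ((-B i l).toNat : ℤ)) = fun i => B i l := by
      funext i
      simp only [Pi.sub_apply]
      omega
    rw [this]
    have h2 := congrFun (congrFun (Matrix.adjugate_mul B) j) l
    rw [Matrix.mul_apply, Matrix.smul_apply, Matrix.one_apply] at h2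
    change ∑ i, _ = _
    rw [h2]
    simp
  obtain ⟨H', hH'⟩ := LaurentRing.dvd_of_binomial_dvd_mul φ
    (by have := hφ k; rw [if_neg hjk] at this; exact sub_eq_zero.mp this)
    (by have := hφ j; rw [if_pos rfl] at this; exact sub_ne_zero.mp (this ▸ h.det_ne_zero))
    ⟨H, hinj hGH⟩
  refine ⟨_, eval_mem_laurentAlg hx H', ?_⟩
  rw [hH', map_mul, hexch]

end IsNondegSeed

end ClusterMutation

end ClusterAlg
namespace ClusterAlg

/-! ### Invariance of upper bounds and the Laurent phenomenon for nondegenerate seeds. -/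

section UpperBound

variable {ι : Type*} {K : Type*} [Field K]

/-- The Laurent ring in the variables with indices different from `j` and `k`. -/
noncomputable def laurentAlgCompl (x : ι → K) (j k : ι) : Subalgebra ℤ K :=
  Algebra.adjoin ℤ {f | ∃ i, i ≠ j ∧ i ≠ k ∧ (f = x i ∨ f = (x i)⁻¹)}

theorem laurentAlg_eq_adjoin_compl {x y : ι → K} (j k : ι)
    (h : ∀ i, i ≠ j → i ≠ k → y i = x i) :
    laurentAlg y = Algebra.adjoin ℤ ((laurentAlgCompl x j k : Set K) ∪
      {y j, (y j)⁻¹, y k, (y k)⁻¹}) := by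
  apply le_antisymm
  · refine Algebra.adjoin_le ?_
    rintro _ (⟨i, rfl⟩ | ⟨i, rfl⟩)
    · by_cases hj : i = j
      · exact Algebra.subset_adjoin (by simp [hj])
      by_cases hk : i = k
      · exact Algebra.subset_adjoin (by simp [hk])
      exact Algebra.subset_adjoin (Or.inl (Algebra.subset_adjoin ⟨i, hj, hk, by simp [h i hj hk]⟩))
    · by_cases hj : i = j
      · exact Algebra.subset_adjoin (by simp [hj])
      by_cases hk : i = k
      · exact Algebra.subset_adjoin (by simp [hk])
      exact Algebra.subset_adjoin (Or.inl (Algebra.subset_adjoin ⟨i, hj, hk, by simp [h i hj hk]⟩))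
  · refine Algebra.adjoin_le ?_
    rintro s (hs | hs | hs | hs | hs)
    · have : laurentAlgCompl x j k ≤ laurentAlg y := by
        refine Algebra.adjoin_le ?_
        rintro _ ⟨i, hj, hk, rfl | rfl⟩
        · rw [← h i hj hk]; exact mem_laurentAlg y i
        · rw [← h i hj hk]; exact inv_mem_laurentAlg y i
      exact this hs
    · rw [hs]; exact mem_laurentAlg y j
    · rw [hs]; exact inv_mem_laurentAlg y j
    · rw [hs]; exact mem_laurentAlg y k
    · rw [Set.mem_singleton_iff.mp hs]; exact inv_mem_laurentAlg y k

variable [Fintype ι]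

theorem exch_mem_laurentAlg (B : Matrix ι ι ℤ) (x : ι → K) (l : ι) : exch B x l ∈ laurentAlg x :=
  Subalgebra.add_mem _
    (Subalgebra.prod_mem _ fun i _ => Subalgebra.pow_mem _ (mem_laurentAlg x i) _)
    (Subalgebra.prod_mem _ fun i _ => Subalgebra.pow_mem _ (mem_laurentAlg x i) _)

variable [DecidableEq ι]

/-- The product of the variables with indices different from `j` and `k`. -/
def prodCompl (x : ι → K) (j k : ι) (e : ι → ℕ) : K :=
  ∏ i ∈ (Finset.univ.erase j).erase k, x i ^ e i

theorem prod_eq_mul_prodCompl (x : ι → K) {j k : ι} (hjk : j ≠ k) (e : ι → ℕ) :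
    ∏ i, x i ^ e i = x j ^ e j * x k ^ e k * prodCompl x j k e := by
  rw [prodCompl, ← Finset.mul_prod_erase _ _ (Finset.mem_univ j), ← Finset.mul_prod_erase _ _
    (Finset.mem_erase.mpr ⟨hjk.symm, Finset.mem_univ k⟩), mul_assoc]

theorem prodCompl_congr {x y : ι → K} {j k : ι} (h : ∀ i, i ≠ j → i ≠ k → y i = x i)
    (e : ι → ℕ) : prodCompl y j k e = prodCompl x j k e := by
  refine Finset.prod_congr rfl fun i hi => ?_
  rw [Finset.mem_erase, Finset.mem_erase] at hi
  rw [h i hi.2.1 hi.1]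

theorem prodCompl_mem (x : ι → K) (j k : ι) (e : ι → ℕ) :
    prodCompl x j k e ∈ laurentAlgCompl x j k := by
  refine Subalgebra.prod_mem _ fun i hi => Subalgebra.pow_mem _ (Algebra.subset_adjoin ?_) _
  rw [Finset.mem_erase, Finset.mem_erase] at hi
  exact ⟨i, hi.2.1, hi.1, Or.inl rfl⟩

theorem inv_prodCompl_mem (x : ι → K) (j k : ι) (e : ι → ℕ) :
    (prodCompl x j k e)⁻¹ ∈ laurentAlgCompl x j k := by
  rw [prodCompl, ← Finset.prod_inv_distrib]
  simp only [← inv_pow]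
  refine Subalgebra.prod_mem _ fun i hi => Subalgebra.pow_mem _ (Algebra.subset_adjoin ?_) _
  rw [Finset.mem_erase, Finset.mem_erase] at hi
  exact ⟨i, hi.2.1, hi.1, Or.inr rfl⟩

theorem prodCompl_ne_zero {x : ι → K} (hx : ∀ i, x i ≠ 0) (j k : ι) (e : ι → ℕ) :
    prodCompl x j k e ≠ 0 :=
  Finset.prod_ne_zero_iff.mpr fun i _ => pow_ne_zero _ (hx i)

namespace IsNondegSeed

variable [Algebra ℚ K] {B : Matrix ι ι ℤ} {x : ι → K}

/-- The rank two step with a = x_j, b = x_k and c = B k j, the remaining variables and their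
inverses being absorbed into the coefficient ring. -/
theorem mem_laurentAlg_mutate_mutate_of_pos (h : IsNondegSeed B x) {j k : ι} (hc : 0 < B k j)
    {f : K} (h0 : f ∈ laurentAlg x) (hj : f ∈ laurentAlg (clMut B x j))
    (hk : f ∈ laurentAlg (clMut B x k)) :
    f ∈ laurentAlg (clMut (matMut B k) (clMut B x k) j) := by
  have hjk : j ≠ k := by
    rintro rfl
    rw [diag_eq_zero_of_skew h.skew] at hc
    exact lt_irrefl _ hc
  have hs := h.mutate k
  have ht := hs.mutate j
  have hjj := diag_eq_zero_of_skew h.skew j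
  have hkk := diag_eq_zero_of_skew h.skew k
  have hc' : B j k = -B k j := h.skew j k
  set s := clMut B x k with hsdef
  set t := clMut (matMut B k) s j with htdef
  have hsx : ∀ i, i ≠ j → i ≠ k → s i = x i := fun i _ hi => clMut_of_ne _ _ hi
  have htx : ∀ i, i ≠ j → i ≠ k → t i = x i := fun i hi hi' =>
    (clMut_of_ne _ _ hi).trans (clMut_of_ne _ _ hi')
  have hjx : ∀ i, i ≠ j → i ≠ k → clMut B x j i = x i := fun i hi _ => clMut_of_ne _ _ hi
  have hsj : s j = x j := clMut_of_ne _ _ hjk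
  have htk : t k = s k := clMut_of_ne _ _ hjk.symm
  set c := (B k j).toNat with hcdef
  have hcc : (c : ℤ) = B k j := Int.toNat_of_nonneg hc.le
  set U := prodCompl x j k fun i => (B i j).toNat with hU
  set V := prodCompl x j k fun i => (-B i j).toNat with hV
  set C := prodCompl x j k fun i => (B i k).toNat with hC
  set D := prodCompl x j k fun i => (-B i k).toNat with hD
  set V' := prodCompl x j k fun i => (-matMut B k i j).toNat with hV'
  set U' := prodCompl x j k fun i => (matMut B k i j).toNat with hU'
  have hV0 : V ≠ 0 := prodCompl_ne_zero h.ne_zero _ _ _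
  have hV'0 : V' ≠ 0 := prodCompl_ne_zero h.ne_zero _ _ _
  have hexj : exch B x j = x k ^ c * U + V := by
    rw [exch, prod_eq_mul_prodCompl x hjk, prod_eq_mul_prodCompl x hjk, hjj, ← hcdef,
      show (-B k j).toNat = 0 by omega]
    simp [hU, hV]
  have hexk : exch B x k = C + x j ^ c * D := by
    rw [exch, prod_eq_mul_prodCompl x hjk, prod_eq_mul_prodCompl x hjk, hkk, hc', neg_neg, ← hcdef,
      show (-B k j).toNat = 0 by omega]
    simp [hC, hD]
  have hexj' : exch (matMut B k) s j = U' + s k ^ c * V' := by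
    rw [exch, prod_eq_mul_prodCompl s hjk, prod_eq_mul_prodCompl s hjk,
      diag_eq_zero_of_skew hs.skew j, show matMut B k k j = -B k j by simp [matMut], neg_neg,
      ← hcdef, show (-B k j).toNat = 0 by omega, prodCompl_congr hsx, prodCompl_congr hsx]
    simp [hU', hV']
  -- Mutation at `k` adds c [B i k]₊ to the entry (i, j), so U' / V' = (U / V) C ^ c. Cancellation
  -- may change V' itself; the monomial unit w = V' / V accounts for this.
  have hUV : U' * V = V' * (U * C ^ c) := by
    simp only [hU', hV', hU, hV, hC, prodCompl, ← Finset.prod_pow, ← Finset.prod_mul_distrib,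
      ← pow_mul, ← pow_add]
    refine Finset.prod_congr rfl fun i hi => ?_
    rw [Finset.mem_erase, Finset.mem_erase] at hi
    have hB' : matMut B k i j = B i j + max (B i k) 0 * c := by
      simp only [matMut, hi.1, hjk, or_self, if_false, half_abs_mul_add]
      rw [hcc, max_eq_left hc.le, max_eq_right (by omega : -B k j ≤ 0)]
      ring
    congr 1
    zify
    rw [hB']
    simp only [Int.ofNat_toNat]
    generalize max (B i k) 0 * (c : ℤ) = z
    omega
  have hbE : x k ∈ (IntermediateField.adjoin ℚ (x '' {j}ᶜ)).toSubfield :=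
    IntermediateField.subset_adjoin ℚ _ (Set.mem_image_of_mem x hjk.symm)
  have hRE : ∀ r ∈ laurentAlgCompl x j k,
      r ∈ (IntermediateField.adjoin ℚ (x '' {j}ᶜ)).toSubfield := by
    intro r hr
    induction hr using Algebra.adjoin_induction with
    | mem s hs =>
      obtain ⟨i, hij, -, rfl | rfl⟩ := hs
      · exact IntermediateField.subset_adjoin ℚ _ (Set.mem_image_of_mem x hij)
      · exact inv_mem (IntermediateField.subset_adjoin ℚ _ (Set.mem_image_of_mem x hij))
    | algebraMap r => exact intCast_mem _ r
    | add u v _ _ hu hv => exact add_mem hu hv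
    | mul u v _ _ hu hv => exact mul_mem hu hv
  rw [laurentAlg_eq_adjoin_compl j k fun i _ _ => rfl] at h0
  rw [laurentAlg_eq_adjoin_compl j k hjx, clMut_self, clMut_of_ne _ _ hjk.symm, hexj] at hj
  rw [laurentAlg_eq_adjoin_compl j k hsx, hsj] at hk
  rw [laurentAlg_eq_adjoin_compl j k htx, htk]
  refine mem_laurent_of_rank_two (laurentAlgCompl x j k)
    (IntermediateField.adjoin ℚ (x '' {j}ᶜ)).toSubfield hRE (w := V' / V) (c := c) (U := U)
    (V := V) (C := C) (D := D) hbE (h.ne_zero k)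
    (AlgebraicIndependent.transcendental_adjoin_compl h.indep j)
    (prodCompl_mem _ _ _ _) (prodCompl_mem _ _ _ _) (prodCompl_mem _ _ _ _) (prodCompl_mem _ _ _ _) ?_
    (inv_prodCompl_mem _ _ _ _) (prodCompl_ne_zero h.ne_zero _ _ _) ?_ (div_ne_zero hV'0 hV0) (by omega)
    ?_ (hs.ne_zero k) (hexj ▸ h.exch_ne_zero j) ?_ (ht.ne_zero j) h0 hj hk
  · rw [div_eq_mul_inv]
    exact Subalgebra.mul_mem _ (prodCompl_mem _ _ _ _) (inv_prodCompl_mem _ _ _ _)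
  · rw [inv_div, div_eq_mul_inv]
    exact Subalgebra.mul_mem _ (prodCompl_mem _ _ _ _) (inv_prodCompl_mem _ _ _ _)
  · rw [hsdef, clMut_self, hexk]
  · rw [htdef, clMut_self, hexj', hsj]
    congr 1
    field_simp
    linear_combination hUV

/-- The only generator that needs a denominator in the mutated Laurent ring is x_k⁻¹, which is the
new variable divided by the exchange binomial. -/
theorem exists_exch_pow_mul_mem (h : IsNondegSeed B x) (k : ι) {f : K} (hf : f ∈ laurentAlg x) :
    ∃ N : ℕ, exch B x k ^ N * f ∈ laurentAlg (clMut B x k) := by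
  have he : exch B x k ∈ laurentAlg (clMut B x k) := by
    rw [← exch_matMut_clMut h.skew x k]
    exact exch_mem_laurentAlg _ _ _
  have hk : x k = exch B x k * (clMut B x k k)⁻¹ := by
    rw [clMut_self, inv_div, mul_div_cancel₀ _ (h.exch_ne_zero k)]
  refine exists_pow_mul_mem_of_mem_adjoin _ he ?_ hf
  rintro _ (⟨i, rfl⟩ | ⟨i, rfl⟩)
  · refine ⟨0, ?_⟩
    rw [pow_zero, one_mul]
    by_cases hi : i = k
    · rw [hi, hk]
      exact Subalgebra.mul_mem _ he (inv_mem_laurentAlg _ k)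
    · rw [← clMut_of_ne B x hi]
      exact mem_laurentAlg _ i
  · by_cases hi : i = k
    · refine ⟨1, ?_⟩
      rw [hi, pow_one, ← div_eq_mul_inv, ← clMut_self]
      exact mem_laurentAlg _ k
    · refine ⟨0, ?_⟩
      change _ * (x i)⁻¹ ∈ _
      rw [pow_zero, one_mul, ← clMut_of_ne B x hi]
      exact inv_mem_laurentAlg _ i

/-- Mutations at unjoined vertices commute, so the final cluster is one mutation away from both
neighbours. Hence `f` enters its Laurent ring after multiplication by a power of either exchange
binomial, and these form a regular sequence. -/
theorem mem_laurentAlg_mutate_mutate_of_eq_zero (h : IsNondegSeed B x) {j k : ι} (hjk : j ≠ k)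
    (hc : B k j = 0) {f : K} (hj : f ∈ laurentAlg (clMut B x j))
    (hk : f ∈ laurentAlg (clMut B x k)) :
    f ∈ laurentAlg (clMut (matMut B k) (clMut B x k) j) := by
  have hs := h.mutate k
  have ht := hs.mutate j
  have hkj : B j k = 0 := by rw [h.skew, hc, neg_zero]
  have hskj : matMut B k j k = 0 := by simp [matMut, hkj]
  set s := clMut B x k with hsdef
  set t := clMut (matMut B k) s j with htdef
  have htj : t j = exch (matMut B k) s j / x j := by
    rw [htdef, clMut_self, hsdef, clMut_of_ne _ _ hjk]
  have htk : t k = exch B x k / x k := by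
    rw [htdef, clMut_of_ne _ _ hjk.symm, hsdef, clMut_self]
  have hpj : exch (matMut (matMut B k) j) t j = exch (matMut B k) s j :=
    exch_matMut_clMut hs.skew s j
  have hpk : exch (matMut (matMut B k) j) t k = exch B x k := by
    rw [← exch_matMut_clMut h.skew x k]
    refine exch_congr (fun i => matMut_apply_of_eq_zero hjk.symm hskj i) fun i hi => ?_
    refine clMut_of_ne _ _ ?_
    rintro rfl
    rw [matMut_apply_of_eq_zero hjk.symm hskj, hskj] at hi
    exact hi rfl
  have hmem := exch_mem_laurentAlg (matMut (matMut B k) j) t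
  obtain ⟨M, hM⟩ := hs.exists_exch_pow_mul_mem j hk
  obtain ⟨N, hN⟩ := (h.mutate j).exists_exch_pow_mul_mem k hj
  have hex : ∀ {l l' : ι}, l ≠ l' → B l' l = 0 → B l l' = 0 →
      exch (matMut B l') (clMut B x l') l = exch B x l := by
    intro l l' hll h1 h2
    refine exch_congr (fun i => matMut_apply_of_eq_zero hll h1 i) fun i hi => clMut_of_ne _ _ ?_
    rintro rfl
    rw [matMut_apply_of_eq_zero hll h1, h1] at hi
    exact hi rfl
  have ht' : clMut (matMut B j) (clMut B x j) k = t := by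
    funext i
    by_cases hik : i = k
    · rw [hik, htk, clMut_self, hex hjk.symm hkj hc, clMut_of_ne _ _ hjk.symm]
    · rw [clMut_of_ne _ _ hik]
      by_cases hij : i = j
      · rw [hij, htj, clMut_self, hsdef, hex hjk hc hkj]
      · rw [clMut_of_ne _ _ hij, htdef, clMut_of_ne _ _ hij, hsdef, clMut_of_ne _ _ hik]
  rw [ht', hex hjk.symm hkj hc, ← hpk] at hN
  rw [← hpj] at hM
  exact mem_of_regular (laurentAlg t) (hmem j) (hmem k) (ht.exch_ne_zero k)
    (fun G hG H hH hGH => ht.exch_regular hjk hG hH hGH) hM hN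

theorem mem_laurentAlg_mutate_mutate (h : IsNondegSeed B x) {f : K} (h0 : f ∈ laurentAlg x)
    (hf : ∀ k, f ∈ laurentAlg (clMut B x k)) (j k : ι) :
    f ∈ laurentAlg (clMut (matMut B k) (clMut B x k) j) := by
  by_cases hjk : j = k
  · rwa [hjk, h.clMut_clMut k]
  rcases lt_trichotomy (B k j) 0 with hc | hc | hc
  -- Negating the matrix only swaps the two monomials of each binomial, so the clusters do not
  -- change.
  · have := h.neg.mem_laurentAlg_mutate_mutate_of_pos (j := j) (k := k) (f := f)
      (by simpa using hc) h0 (by rw [clMut_neg]; exact hf j) (by rw [clMut_neg]; exact hf k)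
    rwa [matMut_neg, clMut_neg, clMut_neg] at this
  · exact h.mem_laurentAlg_mutate_mutate_of_eq_zero hjk hc (hf j) (hf k)
  · exact h.mem_laurentAlg_mutate_mutate_of_pos hc h0 (hf j) (hf k)

end IsNondegSeed

/-- One mutation of an exchange matrix together with a cluster, in a direction satisfying `p`. -/
def MutStep (p : ι → Prop) (q q' : Matrix ι ι ℤ × (ι → K)) : Prop :=
  ∃ k, p k ∧ q' = (matMut q.1 k, clMut q.1 q.2 k)

/-- Membership in the Laurent rings of a seed and of all its neighbours. -/
def InUpperBound (B : Matrix ι ι ℤ) (x : ι → K) (f : K) : Prop :=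
  f ∈ laurentAlg x ∧ ∀ k, f ∈ laurentAlg (clMut B x k)

namespace IsNondegSeed

variable [Algebra ℚ K] {B : Matrix ι ι ℤ} {x : ι → K}

theorem inUpperBound_mutate (h : IsNondegSeed B x) {f : K} (hf : InUpperBound B x f) (k : ι) :
    InUpperBound (matMut B k) (clMut B x k) f :=
  ⟨hf.2 k, fun j => h.mem_laurentAlg_mutate_mutate hf.1 hf.2 j k⟩

theorem inUpperBound_of_mutate (h : IsNondegSeed B x) {f : K} (k : ι)
    (hf : InUpperBound (matMut B k) (clMut B x k) f) : InUpperBound B x f := by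
  have := (h.mutate k).inUpperBound_mutate hf k
  rwa [matMut_matMut, h.clMut_clMut k] at this

theorem inUpperBound_cluster (h : IsNondegSeed B x) (i : ι) : InUpperBound B x (x i) := by
  refine ⟨mem_laurentAlg x i, fun k => ?_⟩
  by_cases hi : i = k
  · have : x i = exch (matMut B k) (clMut B x k) k * (clMut B x k k)⁻¹ := by
      rw [exch_matMut_clMut h.skew, clMut_self, inv_div, mul_div_cancel₀ _ (h.exch_ne_zero k), hi]
    rw [this]
    exact Subalgebra.mul_mem _ (exch_mem_laurentAlg _ _ _) (inv_mem_laurentAlg _ k)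
  · rw [← clMut_of_ne B x hi]
    exact mem_laurentAlg _ i

/-- The Laurent phenomenon for nondegenerate seeds. -/
theorem laurent (h : IsNondegSeed B x) {p : ι → Prop} {q : Matrix ι ι ℤ × (ι → K)}
    (hq : Relation.ReflTransGen (MutStep p) (B, x) q) :
    IsNondegSeed q.1 q.2 ∧ ∀ i, q.2 i ∈ laurentAlg x := by
  -- The induction carries an inclusion of upper bounds, not just Laurentness; each cluster lies in
  -- the upper bound of its own seed.
  suffices IsNondegSeed q.1 q.2 ∧ ∀ f, InUpperBound q.1 q.2 f → InUpperBound B x f from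
    ⟨this.1, fun i => (this.2 _ (this.1.inUpperBound_cluster i)).1⟩
  induction hq with
  | refl => exact ⟨h, fun _ hf => hf⟩
  | tail _ hs ih =>
    obtain ⟨k, -, rfl⟩ := hs
    exact ⟨ih.1.mutate k, fun f hf => ih.2 f (ih.1.inUpperBound_of_mutate k hf)⟩

end IsNondegSeed

end UpperBound

end ClusterAlg
namespace ClusterAlg

/-! ### No negative powers of frozen variables. -/

section FrozenVariable

variable {ι : Type*}

theorem LaurentRing.coeff_gradingHom_id (φ : (ι → ℤ) →+ ℤ) (f : LaurentRing ι) (n : ℤ)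
    (a : ι → ℤ) : ((gradingHom (RingHom.id _) φ f).coeff n).coeff a =
      if φ a = n then f.coeff a else 0 := by
  induction f using AddMonoidAlgebra.induction_linear with
  | zero => simp
  | add f g hf hg =>
    rw [map_add, AddMonoidAlgebra.coeff_add, Finsupp.add_apply, AddMonoidAlgebra.coeff_add,
      Finsupp.add_apply, hf, hg, AddMonoidAlgebra.coeff_add, Finsupp.add_apply]
    split_ifs <;> simp
  | single b c =>
    classical
    rw [gradingHom_single, RingHom.id_apply, ← LaurentPolynomial.single_eq_C_mul_T,
      AddMonoidAlgebra.smul_single, AddMonoidAlgebra.smul_single, smul_eq_mul, mul_one,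
      AddMonoidAlgebra.coeff_single, AddMonoidAlgebra.coeff_single, Finsupp.single_apply,
      Finsupp.single_apply]
    by_cases hab : b = a
    · subst hab
      by_cases hn : φ b = n <;> simp [hn]
    · rw [if_neg hab]
      split_ifs <;> simp [hab]

variable [Fintype ι]

instance : IsDomain (LaurentRing ι) := inferInstance

/-- Laurent polynomials without negative powers of the variable `z` whose value at `z = 0` (all
other variables being `1`) satisfies `P`. -/
def IsRegularAt (z : ι) (P : ℤ → Prop) (g : LaurentRing ι) : Prop :=
  ∃ p : Polynomial (LaurentRing ι),
    LaurentRing.gradingHom (RingHom.id _) (Pi.evalAddMonoidHom (fun _ => ℤ) z) g =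
      Polynomial.toLaurent p ∧ P (LaurentRing.eval (S := ℤ) 1 (p.coeff 0))

namespace IsRegularAt

variable {z : ι} {g h : LaurentRing ι}

theorem mono {P Q : ℤ → Prop} (hPQ : ∀ n, P n → Q n) (hg : IsRegularAt z P g) :
    IsRegularAt z Q g :=
  let ⟨p, h, hp⟩ := hg
  ⟨p, h, hPQ _ hp⟩

theorem mul {P Q S : ℤ → Prop} (hPQ : ∀ m n, P m → Q n → S (m * n)) (hg : IsRegularAt z P g)
    (hh : IsRegularAt z Q h) : IsRegularAt z S (g * h) := by
  obtain ⟨p, hp, hp'⟩ := hg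
  obtain ⟨q, hq, hq'⟩ := hh
  exact ⟨p * q, by rw [map_mul, hp, hq, map_mul], by
    rw [Polynomial.mul_coeff_zero, map_mul]; exact hPQ _ _ hp' hq'⟩

theorem add {P Q S : ℤ → Prop} (hPQ : ∀ m n, P m → Q n → S (m + n)) (hg : IsRegularAt z P g)
    (hh : IsRegularAt z Q h) : IsRegularAt z S (g + h) := by
  obtain ⟨p, hp, hp'⟩ := hg
  obtain ⟨q, hq, hq'⟩ := hh
  exact ⟨p + q, by rw [map_add, hp, hq, map_add], by
    rw [Polynomial.coeff_add, map_add]; exact hPQ _ _ hp' hq'⟩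

theorem one : IsRegularAt z (0 < ·) 1 :=
  ⟨1, by simp, by simp⟩

theorem single_of_ne [DecidableEq ι] {i : ι} (hi : i ≠ z) :
    IsRegularAt z (0 < ·) (AddMonoidAlgebra.single (Pi.single i 1) 1) := by
  refine ⟨Polynomial.C (AddMonoidAlgebra.single (Pi.single i 1) 1), ?_, ?_⟩
  · rw [LaurentRing.gradingHom_single, one_smul, RingHom.id_apply, Pi.evalAddMonoidHom_apply,
      Pi.single_eq_of_ne hi.symm, LaurentPolynomial.T_zero, mul_one, Polynomial.toLaurent_C]
  · rw [Polynomial.coeff_C_zero, LaurentRing.eval_single_piSingle]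
    simp

theorem single_self [DecidableEq ι] :
    IsRegularAt z (0 ≤ ·) (AddMonoidAlgebra.single (Pi.single z 1) 1) := by
  refine ⟨Polynomial.C (AddMonoidAlgebra.single (Pi.single z 1) 1) * Polynomial.X, ?_, ?_⟩
  · rw [LaurentRing.gradingHom_single, one_smul, RingHom.id_apply, Pi.evalAddMonoidHom_apply,
      Pi.single_eq_same, map_mul, Polynomial.toLaurent_C, Polynomial.toLaurent_X]
  · simp

/-- Viewed as a polynomial in z, `h` has nonzero constant term, so the prime z does not divide it.
Any power of z in the denominator of `f` must therefore cancel against `f`. -/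
theorem exponent_nonneg_of_mul {f : LaurentRing ι} (hg : IsRegularAt z (0 < ·) g)
    (hh : IsRegularAt z (0 < ·) h) (hf : f * h = g) {a : ι → ℤ} (ha : f.coeff a ≠ 0) :
    0 ≤ a z := by
  obtain ⟨p, hp, -⟩ := hg
  obtain ⟨q, hq, hq'⟩ := hh
  have hq0 : q.coeff 0 ≠ 0 := by
    intro h0
    rw [h0, map_zero] at hq'
    exact lt_irrefl _ hq'
  obtain ⟨n, r, hr⟩ := LaurentPolynomial.exists_T_pow
    (LaurentRing.gradingHom (RingHom.id _) (Pi.evalAddMonoidHom (fun _ => ℤ) z) f)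
  have h1 : r * q = Polynomial.X ^ n * p := by
    apply Polynomial.toLaurent_injective
    rw [map_mul, hr, ← hq, mul_right_comm, ← map_mul, hf, hp, map_mul, Polynomial.toLaurent_X_pow,
      mul_comm]
  obtain ⟨r', hr'⟩ : Polynomial.X ^ n ∣ r :=
    Polynomial.prime_X.pow_dvd_of_dvd_mul_right n
      (fun h => hq0 (Polynomial.X_dvd_iff.mp h)) ⟨p, h1⟩
  have h2 : LaurentRing.gradingHom (RingHom.id _) (Pi.evalAddMonoidHom (fun _ => ℤ) z) f =
      Polynomial.toLaurent r' := by
    rw [hr', map_mul, Polynomial.toLaurent_X_pow, mul_comm] at hr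
    exact ((LaurentPolynomial.isUnit_T n).mul_left_injective hr).symm
  have h3 := LaurentRing.coeff_gradingHom_id (Pi.evalAddMonoidHom (fun _ => ℤ) z) f (a z) a
  rw [h2, Pi.evalAddMonoidHom_apply, if_pos rfl] at h3
  by_contra hneg
  apply ha
  rw [← h3, LaurentPolynomial.coeff_toLaurent]
  rw [Finsupp.mapDomain_of_notMem_range]
  · rfl
  · rintro ⟨k, hk⟩
    have : (k : ℤ) = a z := hk
    omega

end IsRegularAt

variable {K : Type*} [Field K] {X : ι → K} (hX : ∀ i, X i ≠ 0)

/-- Quotients `g / h` of Laurent polynomials in `X` with `g` and `h` free of negative powers of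
`X z`, the value of `g` at `X z = 0` satisfying `P` and that of `h` being positive. -/
def IsQuotAt (z : ι) (P : ℤ → Prop) (f : K) : Prop :=
  ∃ g h : LaurentRing ι, IsRegularAt z P g ∧ IsRegularAt z (0 < ·) h ∧
    f * LaurentRing.eval (fun i => Units.mk0 (X i) (hX i)) h =
      LaurentRing.eval (fun i => Units.mk0 (X i) (hX i)) g

namespace IsQuotAt

variable {hX} {z : ι} {f f' : K}

theorem mono {P Q : ℤ → Prop} (hPQ : ∀ n, P n → Q n) (hf : IsQuotAt hX z P f) :
    IsQuotAt hX z Q f :=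
  let ⟨g, h, hg, hh, e⟩ := hf
  ⟨g, h, hg.mono hPQ, hh, e⟩

theorem mul {P : ℤ → Prop} (hP : ∀ m n, P m → P n → P (m * n)) (hf : IsQuotAt hX z P f)
    (hf' : IsQuotAt hX z P f') : IsQuotAt hX z P (f * f') := by
  obtain ⟨g, h, hg, hh, e⟩ := hf
  obtain ⟨g', h', hg', hh', e'⟩ := hf'
  refine ⟨g * g', h * h', hg.mul hP hg', hh.mul (fun _ _ => mul_pos) hh', ?_⟩
  rw [map_mul, map_mul, ← e, ← e']
  ring

theorem add (hf : IsQuotAt hX z (0 < ·) f) (hf' : IsQuotAt hX z (0 ≤ ·) f') :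
    IsQuotAt hX z (0 < ·) (f + f') := by
  obtain ⟨g, h, hg, hh, e⟩ := hf
  obtain ⟨g', h', hg', hh', e'⟩ := hf'
  refine ⟨g * h' + g' * h, h * h', (hg.mul (fun _ _ => mul_pos) hh').add
    (fun _ _ => add_pos_of_pos_of_nonneg)
    (hg'.mul (S := (0 ≤ ·)) (fun _ _ h1 h2 => mul_nonneg h1 (le_of_lt h2)) hh),
    hh.mul (fun _ _ => mul_pos) hh', ?_⟩
  rw [map_add, map_mul, map_mul, map_mul, ← e, ← e']
  ring

theorem inv (hf : IsQuotAt hX z (0 < ·) f) (hf0 : f ≠ 0) : IsQuotAt hX z (0 < ·) f⁻¹ := by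
  obtain ⟨g, h, hg, hh, e⟩ := hf
  exact ⟨h, g, hh, hg, by rw [← e, inv_mul_cancel_left₀ hf0]⟩

theorem one : IsQuotAt hX z (0 < ·) 1 :=
  ⟨1, 1, .one, .one, by simp⟩

theorem prod_pow {P : ℤ → Prop} (hP : ∀ m n, P m → P n → P (m * n)) (h1 : ∀ n, 0 < n → P n)
    {x : ι → K} {e : ι → ℕ} (hx : ∀ i, e i ≠ 0 → IsQuotAt hX z P (x i)) :
    IsQuotAt hX z P (∏ i, x i ^ e i) := by
  have hone : IsQuotAt hX z P (1 : K) := one.mono h1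
  refine Finset.prod_induction _ (IsQuotAt hX z P) (fun _ _ => mul hP) hone fun i _ => ?_
  by_cases hi : e i = 0
  · rwa [hi, pow_zero]
  · generalize e i = n
    induction n with
    | zero => rwa [pow_zero]
    | succ n ih => rw [pow_succ]; exact ih.mul hP (hx i hi)

theorem cluster_self [DecidableEq ι] : IsQuotAt hX z (0 ≤ ·) (X z) :=
  ⟨_, 1, .single_self, .one, by simp [LaurentRing.eval_single_piSingle]⟩

theorem cluster_of_ne [DecidableEq ι] {i : ι} (hi : i ≠ z) : IsQuotAt hX z (0 < ·) (X i) :=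
  ⟨_, 1, .single_of_ne hi, .one, by simp [LaurentRing.eval_single_piSingle]⟩

/-- The variable with index z occurs in at most one of the two monomials. At X z = 0 the other has a
positive value and this one a nonnegative value. -/
theorem exch {x : ι → K} (hx : ∀ i, i ≠ z → IsQuotAt hX z (0 < ·) (x i))
    (hz : IsQuotAt hX z (0 ≤ ·) (x z)) (B : Matrix ι ι ℤ) (k : ι) :
    IsQuotAt hX z (0 < ·) (ClusterAlg.exch B x k) := by
  have h0 : ∀ e : ι → ℕ, IsQuotAt hX z (0 ≤ ·) (∏ i, x i ^ e i) := by
    refine fun e => prod_pow (fun _ _ => mul_nonneg) (fun _ => le_of_lt) fun i _ => ?_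
    by_cases hi : i = z
    · rwa [hi]
    · exact (hx i hi).mono fun _ => le_of_lt
  have h1 : ∀ e : ι → ℕ, e z = 0 → IsQuotAt hX z (0 < ·) (∏ i, x i ^ e i) := by
    refine fun e he => prod_pow (fun _ _ => mul_pos) (fun _ => id) fun i hi => hx i ?_
    rintro rfl
    exact hi he
  rw [ClusterAlg.exch]
  rcases le_total (B z k) 0 with hB | hB
  · exact (h1 _ (Int.toNat_of_nonpos hB)).add (h0 _)
  · rw [add_comm]
    exact (h1 _ (Int.toNat_of_nonpos (by omega))).add (h0 _)

end IsQuotAt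

end FrozenVariable

end ClusterAlg
namespace ClusterAlg

/-! ### The universal seed in a field of rational functions. -/

section Universal

variable {ι : Type*}

/-- The field of rational functions over `ℚ`. -/
abbrev RatField (ι : Type*) : Type _ := FractionRing (MvPolynomial ι ℚ)

/-- The variables of the field of rational functions. -/
noncomputable def ratVar (i : ι) : RatField ι := algebraMap (MvPolynomial ι ℚ) _ (MvPolynomial.X i)

theorem ratVar_ne_zero (i : ι) : ratVar i ≠ 0 := by
  rw [ratVar, Ne, map_eq_zero_iff _ (IsFractionRing.injective (MvPolynomial ι ℚ) (RatField ι))]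
  exact MvPolynomial.X_ne_zero i

variable [Fintype ι] [DecidableEq ι]

theorem isNondegSeed_ratVar {B : Matrix ι ι ℤ} (hB : ∀ i j, B i j = -B j i) (hdet : B.det ≠ 0) :
    IsNondegSeed B (ratVar (ι := ι)) where
  skew := hB
  det_ne_zero := hdet
  indep := (MvPolynomial.algebraicIndependent_X ι ℚ).map'
    (f := IsScalarTower.toAlgHom ℚ (MvPolynomial ι ℚ) (RatField ι))
    (IsFractionRing.injective (MvPolynomial ι ℚ) (RatField ι))

/-- Mutations avoid z, so the variable at z is never inverted, and all other variables arise by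
sums, products and quotients that preserve positivity at X z = 0. -/
theorem isQuotAt_of_reachable {p : ι → Prop} {z : ι} (hz : ¬ p z) {B : Matrix ι ι ℤ}
    (h : IsNondegSeed B (ratVar (ι := ι))) {q : Matrix ι ι ℤ × (ι → RatField ι)}
    (hq : Relation.ReflTransGen (MutStep p) (B, ratVar) q) :
    IsNondegSeed q.1 q.2 ∧ (∀ i, i ≠ z → IsQuotAt ratVar_ne_zero z (0 < ·) (q.2 i)) ∧
      IsQuotAt ratVar_ne_zero z (0 ≤ ·) (q.2 z) := by
  induction hq with
  | refl => exact ⟨h, fun i hi => .cluster_of_ne hi, .cluster_self⟩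
  | tail _ hs ih =>
    obtain ⟨k, hk, rfl⟩ := hs
    obtain ⟨ih1, ih2, ih3⟩ := ih
    have hkz : k ≠ z := fun h => hz (h ▸ hk)
    refine ⟨ih1.mutate k, fun i hi => ?_, ?_⟩ <;> dsimp only
    · by_cases hik : i = k
      · rw [hik, clMut_self, div_eq_mul_inv]
        exact (IsQuotAt.exch ih2 ih3 _ _).mul (fun _ _ => mul_pos)
          ((ih2 k hkz).inv (ih1.ne_zero k))
      · rw [clMut_of_ne _ _ hik]
        exact ih2 i hi
    · rwa [clMut_of_ne _ _ hkz.symm]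

/-- The Laurent phenomenon: the exponents of frozen variables are nonnegative. -/
theorem exists_laurent_of_reachable {p : ι → Prop} {B : Matrix ι ι ℤ}
    (h : IsNondegSeed B (ratVar (ι := ι))) {q : Matrix ι ι ℤ × (ι → RatField ι)}
    (hq : Relation.ReflTransGen (MutStep p) (B, ratVar) q) {i : ι} (hi : p i) :
    ∃ g : LaurentRing ι,
      LaurentRing.eval (fun i => Units.mk0 (ratVar i) (ratVar_ne_zero i)) g = q.2 i ∧
      ∀ a, g.coeff a ≠ 0 → ∀ z, ¬ p z → 0 ≤ a z := by
  obtain ⟨g, hg⟩ := exists_eval_eq_of_mem_laurentAlg ratVar_ne_zero ((h.laurent hq).2 i)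
  refine ⟨g, hg, fun a ha z hz => ?_⟩
  obtain ⟨-, h2, -⟩ := isQuotAt_of_reachable hz h hq
  obtain ⟨g', h', hg', hh', e⟩ := h2 i (fun h => hz (h ▸ hi))
  refine IsRegularAt.exponent_nonneg_of_mul hg' hh' ?_ ha
  apply h.eval_injective
  rw [map_mul, hg, e]

end Universal

/-! ### Specializing Laurent expansions to another field. -/

section Specialization

variable {ι : Type*} [Fintype ι] [DecidableEq ι] {F : Type*} [Field F]

/-- Specialization of the Laurent expansions: mutations of a cluster `ξ` in an arbitrary field,
with exchange matrices agreeing with those of a universal seed on the mutable columns. -/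
theorem specialize_of_reachable {p : ι → Prop} {B : Matrix ι ι ℤ}
    (h : IsNondegSeed B (ratVar (ι := ι))) {q : Matrix ι ι ℤ × (ι → RatField ι)}
    (hq : Relation.ReflTransGen (MutStep p) (B, ratVar) q) (u : ι → Fˣ)
    {ξ : ι → F} {G : ι → LaurentRing ι}
    (hG : ∀ i, LaurentRing.eval (fun i => Units.mk0 (ratVar i) (ratVar_ne_zero i)) (G i) = q.2 i)
    (hGu : ∀ i, LaurentRing.eval u (G i) = ξ i) {k : ι} (hk : p k) (hξ : ξ k ≠ 0) :
    ∃ G' : ι → LaurentRing ι,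
      (∀ i, LaurentRing.eval (fun i => Units.mk0 (ratVar i) (ratVar_ne_zero i)) (G' i) =
        clMut q.1 q.2 k i) ∧
      ∀ i, LaurentRing.eval u (G' i) = clMut q.1 ξ k i := by
  have hq' : Relation.ReflTransGen (MutStep p) (B, ratVar) (matMut q.1 k, clMut q.1 q.2 k) :=
    hq.tail ⟨k, hk, rfl⟩
  obtain ⟨g, hg, -⟩ := exists_laurent_of_reachable h hq' hk
  dsimp only at hg
  -- Injectivity of evaluation in the universal field turns the exchange relation into a
  -- division-free identity of Laurent polynomials, which survives evaluation at `u`. The division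
  -- by `ξ k` is restored afterwards.
  have hgk : g * G k = exch q.1 G k := by
    apply h.eval_injective
    have hne := (h.laurent hq).1.ne_zero k
    rw [map_mul, hg, hG, clMut_self, div_mul_cancel₀ _ hne, ← RingHom.coe_coe, map_exch]
    simp only [RingHom.coe_coe, hG]
  refine ⟨Function.update G k g, fun i => ?_, fun i => ?_⟩
  · by_cases hi : i = k
    · rw [hi, Function.update_self, hg]
    · rw [Function.update_of_ne hi, clMut_of_ne _ _ hi, hG]
  · by_cases hi : i = k
    · rw [hi, Function.update_self, clMut_self, eq_div_iff hξ, ← hGu k, ← map_mul, hgk,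
        ← RingHom.coe_coe, map_exch]
      simp only [RingHom.coe_coe, hGu]
    · rw [Function.update_of_ne hi, clMut_of_ne _ _ hi, hGu]

end Specialization

end ClusterAlg
namespace ClusterAlg

namespace Seed

/-! ### Seeds of geometric type as extended clusters and matrices. -/

section ExtendedMatrix

variable {n m : ℕ} {F : Type*}

/-- The extended exchange matrix of a seed of geometric type. -/
def extMat (t : Seed (Trop m) F n) : Matrix (Fin n ⊕ Fin m) (Fin n ⊕ Fin m) ℤ :=
  Matrix.fromBlocks t.B (fun i a => -(t.y i).toAdd a) (fun a i => (t.y i).toAdd a) 0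

theorem extMat_inl_inl (t : Seed (Trop m) F n) (i j : Fin n) :
    t.extMat (Sum.inl i) (Sum.inl j) = t.B i j := rfl

theorem extMat_inr_inl (t : Seed (Trop m) F n) (a : Fin m) (i : Fin n) :
    t.extMat (Sum.inr a) (Sum.inl i) = (t.y i).toAdd a := rfl

end ExtendedMatrix

section Geometric

variable {n m : ℕ} {F : Type*} [Field F] [Algebra (MonoidAlgebra ℤ (Trop m)) F]

/-- The monomial of `F` with a given exponent vector. -/
noncomputable def coeffMonomial (F : Type*) [Field F] [Algebra (MonoidAlgebra ℤ (Trop m)) F] :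
    Trop m →* F :=
  (algebraMap (MonoidAlgebra ℤ (Trop m)) F : _ →* F).comp (MonoidAlgebra.of ℤ (Trop m))

theorem coeffMonomial_ne_zero (y : Trop m) : coeffMonomial F y ≠ 0 := by
  intro h
  have := map_mul (coeffMonomial F) y y⁻¹
  rw [mul_inv_cancel, map_one, h, zero_mul] at this
  exact one_ne_zero this

theorem prod_coeffMonomial_pow (e : Fin m → ℕ) :
    ∏ a, coeffMonomial F (Trop.z a) ^ e a =
      coeffMonomial F (Multiplicative.ofAdd fun a => (e a : ℤ)) := by
  simp only [← map_pow]
  rw [← map_prod]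
  congr 1
  apply Multiplicative.toAdd.injective
  rw [toAdd_prod]
  funext b
  simp [Trop.z, Finset.sum_apply, Pi.single_apply]

/-- The extended cluster of a seed of geometric type. -/
noncomputable def extCluster (t : Seed (Trop m) F n) : Fin n ⊕ Fin m → F :=
  Sum.elim t.x fun a => coeffMonomial F (Trop.z a)

theorem exch_ext_eq (t : Seed (Trop m) F n) (k : Fin n) :
    exch t.extMat t.extCluster (Sum.inl k) =
      coeffMonomial F (Multiplicative.ofAdd fun a => (((t.y k).toAdd a).toNat : ℤ)) *
          ∏ j, t.x j ^ (t.B j k).toNat +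
        coeffMonomial F (Multiplicative.ofAdd fun a => ((-(t.y k).toAdd a).toNat : ℤ)) *
          ∏ j, t.x j ^ (-t.B j k).toNat := by
  rw [exch, Fintype.prod_sum_type, Fintype.prod_sum_type, ← prod_coeffMonomial_pow,
    ← prod_coeffMonomial_pow]
  simp only [extMat_inl_inl, extMat_inr_inl, extCluster, Sum.elim_inl, Sum.elim_inr]
  ring

/-- Tropically, y / (y ⊕ 1) and 1 / (y ⊕ 1) have exponents [a]₊ and [-a]₊, so the normalized
exchange relation is the binomial of the extended matrix. -/
theorem extCluster_mutate (t : Seed (Trop m) F n) (k : Fin n) :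
    (t.mutate k).extCluster = clMut t.extMat t.extCluster (Sum.inl k) := by
  funext i
  rcases i with i | a
  · by_cases hi : i = k
    · subst hi
      rw [clMut_self, exch_ext_eq]
      simp only [extCluster, mutate, Sum.elim_inl, if_true]
      change (coeffMonomial F (t.y i) * _ + _) /
        (coeffMonomial F (CoeffSemifield.oplus (t.y i) 1) * t.x i) = _
      have h1 : coeffMonomial F (CoeffSemifield.oplus (t.y i) 1) * coeffMonomial F
          (Multiplicative.ofAdd fun a => (((t.y i).toAdd a).toNat : ℤ)) =
          coeffMonomial F (t.y i) := by
        rw [← map_mul]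
        congr 1
        apply Multiplicative.toAdd.injective
        funext a
        change min ((t.y i).toAdd a) 0 + (((t.y i).toAdd a).toNat : ℤ) = (t.y i).toAdd a
        omega
      have h2 : coeffMonomial F (CoeffSemifield.oplus (t.y i) 1) * coeffMonomial F
          (Multiplicative.ofAdd fun a => ((-(t.y i).toAdd a).toNat : ℤ)) = 1 := by
        rw [← map_mul, ← map_one (coeffMonomial (m := m) F)]
        congr 1
        apply Multiplicative.toAdd.injective
        funext a
        change min ((t.y i).toAdd a) 0 + ((-(t.y i).toAdd a).toNat : ℤ) = 0
        omega
      have h0 := coeffMonomial_ne_zero (F := F) (CoeffSemifield.oplus (t.y i) 1)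
      rw [← mul_div_mul_left _ (t.x i) h0, mul_add, ← mul_assoc, ← mul_assoc, h1, h2, one_mul]
    · rw [clMut_of_ne _ _ (by simpa using hi)]
      simp [extCluster, mutate, hi]
  · rw [clMut_of_ne _ _ (by simp)]
    rfl

/-- Only mutable columns are compared: `matMut` may create entries between frozen vertices, where
`extMat` has 0. Such entries never enter an exchange at a mutable vertex. -/
theorem extMat_mutate (t : Seed (Trop m) F n) (k l : Fin n) (i : Fin n ⊕ Fin m) :
    (t.mutate k).extMat i (Sum.inl l) = matMut t.extMat (Sum.inl k) i (Sum.inl l) := by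
  rcases i with i | a
  · simp [extMat_inl_inl, mutate, matMut]
  · by_cases hl : l = k
    · simp [extMat_inr_inl, mutate, matMut, hl]
    · simp only [matMut, Sum.inl.injEq, hl, reduceCtorEq, or_self, if_false, half_abs_mul_add]
      simp only [extMat_inr_inl, extMat_inl_inl, mutate, hl, if_false]
      rw [toAdd_mul, toAdd_mul, toAdd_pow, toAdd_zpow]
      change (t.y l).toAdd a + (t.B k l).toNat • (t.y k).toAdd a +
        (-t.B k l) • (min ((t.y k).toAdd a) 0) = _
      rw [nsmul_eq_mul, smul_eq_mul]
      generalize (t.y k).toAdd a = c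
      generalize t.B k l = b
      rw [Int.ofNat_toNat]
      rcases le_total 0 b with h1 | h1 <;> rcases le_total 0 c with h2 | h2
      all_goals simp [h1, h2]
      all_goals ring

/-- Seeds of geometric type with skew-symmetric exchange matrix. -/
structure IsSkew (t : Seed (Trop m) F n) : Prop where
  skew : ∀ i j, t.B i j = -t.B j i
  indep : AlgebraicIndependent
    (Subfield.closure (Set.range (algebraMap (MonoidAlgebra ℤ (Trop m)) F))) t.x

namespace IsSkew

variable {t : Seed (Trop m) F n}

theorem ne_zero (h : t.IsSkew) (i : Fin n) : t.x i ≠ 0 := h.indep.ne_zero i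

theorem extCluster_ne_zero (h : t.IsSkew) (i : Fin n ⊕ Fin m) : t.extCluster i ≠ 0 := by
  rcases i with i | a
  · exact h.ne_zero i
  · exact coeffMonomial_ne_zero _

theorem extMat_skew (h : t.IsSkew) (i j : Fin n ⊕ Fin m) : t.extMat i j = -t.extMat j i := by
  rcases i with i | a <;> rcases j with j | b
  · exact h.skew i j
  · rfl
  · exact (neg_neg _).symm
  · rfl

theorem exch_ne_zero
    (hF : Function.Injective (algebraMap (MonoidAlgebra ℤ (Trop m)) F)) (h : t.IsSkew)
    (k : Fin n) : exch t.extMat t.extCluster (Sum.inl k) ≠ 0 := by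
  rw [exch_ext_eq]
  have hmem : ∀ y, coeffMonomial F y ∈
      Subfield.closure (Set.range (algebraMap (MonoidAlgebra ℤ (Trop m)) F)) :=
    fun y => Subfield.subset_closure ⟨_, rfl⟩
  -- The augmentation of the group ring sends a sum of two monomials to 2.
  have hadd : ∀ y y' : Trop m, coeffMonomial F y + coeffMonomial F y' ≠ 0 := by
    intro y y' h0
    have h1 : algebraMap (MonoidAlgebra ℤ (Trop m)) F
        (MonoidAlgebra.of ℤ (Trop m) y + MonoidAlgebra.of ℤ (Trop m) y') =
        algebraMap (MonoidAlgebra ℤ (Trop m)) F 0 := by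
      rw [map_add, map_zero]
      exact h0
    have h2 := congrArg (MonoidAlgebra.lift ℤ ℤ (Trop m) 1) (hF h1)
    rw [map_add, MonoidAlgebra.lift_of, MonoidAlgebra.lift_of, map_zero] at h2
    simp at h2
  exact AlgebraicIndependent.binomial_ne_zero h.indep
    (p := ⟨_, hmem _⟩) (q := ⟨_, hmem _⟩)
    (fun h0 => coeffMonomial_ne_zero _ (congrArg Subtype.val h0))
    (fun h0 => hadd _ _ (congrArg Subtype.val h0)) _ _

theorem mutate (hF : Function.Injective (algebraMap (MonoidAlgebra ℤ (Trop m)) F))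
    (h : t.IsSkew) (k : Fin n) : (t.mutate k).IsSkew where
  skew := matMut_skew h.skew k
  indep := by
    have hkk := diag_eq_zero_of_skew h.skew k
    have hx : (t.mutate k).x =
        Function.update t.x k (exch t.extMat t.extCluster (Sum.inl k) / t.x k) := by
      funext i
      have := congrFun (extCluster_mutate t k) (Sum.inl i)
      change (t.mutate k).x i = _ at this
      rw [this]
      by_cases hi : i = k
      · rw [hi, clMut_self, Function.update_self]
        rfl
      · rw [clMut_of_ne _ _ (by simpa using hi), Function.update_of_ne hi]
        rfl
    rw [hx]
    refine AlgebraicIndependent.update_div h.indep k ?_ (h.exch_ne_zero hF k)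
    rw [exch_ext_eq]
    have hmem : ∀ y, coeffMonomial F y ∈ IntermediateField.adjoin
        (Subfield.closure (Set.range (algebraMap (MonoidAlgebra ℤ (Trop m)) F)))
        (t.x '' {k}ᶜ) := fun y =>
      IntermediateField.algebraMap_mem _
        (⟨coeffMonomial F y, Subfield.subset_closure ⟨_, rfl⟩⟩ :
          Subfield.closure (Set.range (algebraMap (MonoidAlgebra ℤ (Trop m)) F)))
    exact add_mem (mul_mem (hmem _) (prod_pow_mem_adjoin_compl t.x k (by simp [hkk])))
      (mul_mem (hmem _) (prod_pow_mem_adjoin_compl t.x k (by simp [hkk])))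

theorem mutate_mutate (hF : Function.Injective (algebraMap (MonoidAlgebra ℤ (Trop m)) F))
    (h : t.IsSkew) (k : Fin n) : (t.mutate k).mutate k = t := by
  have hcol : ∀ i l, ((t.mutate k).mutate k).extMat i (Sum.inl l) = t.extMat i (Sum.inl l) := by
    intro i l
    conv_rhs => rw [← matMut_matMut t.extMat (Sum.inl k)]
    rw [extMat_mutate]
    simp only [matMut, extMat_mutate]
  have hx : ((t.mutate k).mutate k).extCluster = t.extCluster := by
    rw [extCluster_mutate]
    conv_rhs => rw [← clMut_clMut h.extMat_skew (h.exch_ne_zero hF k)]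
    rw [extCluster_mutate, clMut, clMut, exch_congr (fun i => extMat_mutate t k k i)
      fun _ _ => rfl]
    rfl
  ext i j
  · exact congrFun hx (Sum.inl i)
  · exact congrFun (congrArg Multiplicative.toAdd (show _ = _ from
      Multiplicative.toAdd.injective (funext fun a => hcol (Sum.inr a) i))) _
  · exact hcol (Sum.inl i) j

/-- The Laurent expansions at `t` of the clusters of seeds reachable from `t`, as specializations of
universal ones. -/
theorem exists_universal_of_reachable
    (hF : Function.Injective (algebraMap (MonoidAlgebra ℤ (Trop m)) F)) (h : t.IsSkew)
    {t' : Seed (Trop m) F n}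
    (ht' : Relation.ReflTransGen (fun a b => ∃ k, b = Seed.mutate k a) t t')
    {B : Matrix ((Fin n ⊕ Fin m) ⊕ (Fin n ⊕ Fin m)) ((Fin n ⊕ Fin m) ⊕ (Fin n ⊕ Fin m)) ℤ}
    (hB : IsNondegSeed B (ratVar (ι := (Fin n ⊕ Fin m) ⊕ (Fin n ⊕ Fin m))))
    (hBt : ∀ e l, B (Sum.inl e) (Sum.inl (Sum.inl l)) = t.extMat e (Sum.inl l))
    (u : (Fin n ⊕ Fin m) ⊕ (Fin n ⊕ Fin m) → Fˣ)
    (hu : ∀ i, (u i : F) = Sum.elim t.extCluster 1 i) :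
    t'.IsSkew ∧ ∃ q, Relation.ReflTransGen
        (MutStep fun s => ∃ i : Fin n, s = Sum.inl (Sum.inl i)) (B, ratVar) q ∧
      (∀ e l, q.1 (Sum.inl e) (Sum.inl (Sum.inl l)) = t'.extMat e (Sum.inl l)) ∧
      ∃ G : (Fin n ⊕ Fin m) ⊕ (Fin n ⊕ Fin m) → LaurentRing ((Fin n ⊕ Fin m) ⊕ (Fin n ⊕ Fin m)),
        (∀ i, LaurentRing.eval (fun i => Units.mk0 (ratVar i) (ratVar_ne_zero i)) (G i) = q.2 i) ∧
        ∀ i, LaurentRing.eval u (G i) = Sum.elim t'.extCluster 1 i := by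
  induction ht' with
  | refl =>
    exact ⟨h, _, .refl, hBt, fun i => AddMonoidAlgebra.single (Pi.single i 1) 1,
      fun i => by simp [LaurentRing.eval_single_piSingle],
      fun i => by simp [LaurentRing.eval_single_piSingle, hu]⟩
  | @tail t₁ _ _ hs ih =>
    obtain ⟨k, rfl⟩ := hs
    obtain ⟨h₁, q, hq, hqB, G, hG, hGu⟩ := ih
    obtain ⟨G', hG', hGu'⟩ := specialize_of_reachable hB hq u hG hGu
      (k := Sum.inl (Sum.inl k)) ⟨k, rfl⟩ (h₁.ne_zero k)
    refine ⟨h₁.mutate hF k, (matMut q.1 _, clMut q.1 q.2 _), hq.tail ⟨_, ⟨k, rfl⟩, rfl⟩,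
      fun e l => ?_, G', hG', fun i => ?_⟩
    · rw [extMat_mutate]
      simp only [matMut, hqB, Sum.inl.injEq]
    · have hex : exch q.1 (Sum.elim t₁.extCluster 1) (Sum.inl (Sum.inl k)) =
          exch t₁.extMat t₁.extCluster (Sum.inl k) := by
        simp [exch, Fintype.prod_sum_type, hqB]
      rw [hGu', extCluster_mutate, clMut, clMut, hex, Sum.elim_inl, Sum.update_elim_inl]

/-- The Laurent phenomenon over the polynomial ground ring. -/
theorem cluster_mem_laurentRing
    (hF : Function.Injective (algebraMap (MonoidAlgebra ℤ (Trop m)) F)) (h : t.IsSkew)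
    {t' : Seed (Trop m) F n}
    (ht' : Relation.ReflTransGen (fun a b => ∃ k, b = Seed.mutate k a) t t') (i : Fin n) :
    t'.x i ∈ laurentRing (polyGroundRing m) t := by
  -- Attaching one extra vertex to every vertex makes the matrix invertible whatever `t.extMat` is.
  -- The extra variables are specialized to 1, so they do not affect the clusters in F.
  let B : Matrix ((Fin n ⊕ Fin m) ⊕ (Fin n ⊕ Fin m)) ((Fin n ⊕ Fin m) ⊕ (Fin n ⊕ Fin m)) ℤ :=
    Matrix.fromBlocks t.extMat (-1) 1 0
  have hskew : ∀ i j, B i j = -B j i := by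
    rintro (i | i) (j | j)
    · exact h.extMat_skew i j
    · simp [B, Matrix.one_apply, eq_comm]
    · simp [B, Matrix.one_apply, eq_comm]
    · simp [B]
  have hdet : B.det ≠ 0 := by
    have hmul : Matrix.fromBlocks 0 1 (-1) t.extMat * B = 1 := by
      simp [B, Matrix.fromBlocks_multiply]
    intro h0
    have := congrArg Matrix.det hmul
    rw [Matrix.det_mul, h0, mul_zero, Matrix.det_one] at this
    exact zero_ne_one this
  have hne : ∀ i : (Fin n ⊕ Fin m) ⊕ (Fin n ⊕ Fin m), Sum.elim t.extCluster 1 i ≠ 0 := by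
    rintro (i | i)
    · exact h.extCluster_ne_zero i
    · exact one_ne_zero
  have hB := isNondegSeed_ratVar hskew hdet
  obtain ⟨-, q, hq, -, G, hG, hGu⟩ := h.exists_universal_of_reachable hF ht' hB
    (fun _ _ => rfl) (fun i => Units.mk0 _ (hne i)) fun _ => rfl
  obtain ⟨g, hg, hpos⟩ := exists_laurent_of_reachable hB hq (i := Sum.inl (Sum.inl i)) ⟨i, rfl⟩
  -- Universal Laurent expansions are unique, so the one with nonnegative frozen exponents is the
  -- one that specializes to the cluster variable.
  have hgG : g = G (Sum.inl (Sum.inl i)) := hB.eval_injective (hg.trans (hG _).symm)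
  have hx : t'.x i = LaurentRing.eval (fun i => Units.mk0 _ (hne i)) g := by
    rw [hgG, hGu]
    rfl
  rw [hx, LaurentRing.eval, AddMonoidAlgebra.lift_apply]
  refine Subalgebra.sum_mem _ fun a ha => Subalgebra.zsmul_mem _ ?_ _
  have ha' := hpos a (Finsupp.mem_support_iff.mp ha)
  change ((∏ i, (Units.mk0 _ (hne i)) ^ a i : Fˣ) : F) ∈ _
  rw [Units.coe_prod]
  refine Subalgebra.prod_mem _ fun s _ => ?_
  rw [Units.val_zpow_eq_zpow_val, Units.val_mk0]
  rcases s with (j | b) | s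
  · have h1 : t.x j ∈ laurentRing (polyGroundRing m) t :=
      Algebra.subset_adjoin (Or.inl ⟨j, rfl⟩)
    have h2 : (t.x j)⁻¹ ∈ laurentRing (polyGroundRing m) t :=
      Algebra.subset_adjoin (Or.inr ⟨j, rfl⟩)
    exact zpow_mem_of_inv_mem h1 h2 _
  · obtain ⟨e, he⟩ := Int.eq_ofNat_of_zero_le (ha' (Sum.inl (Sum.inr b)) (by simp))
    rw [he, zpow_natCast]
    refine Subalgebra.pow_mem _ ?_ _
    exact Subalgebra.algebraMap_mem (laurentRing (polyGroundRing m) t)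
      ⟨MonoidAlgebra.of ℤ (Trop m) (Trop.z b), Subring.subset_closure ⟨b, rfl⟩⟩
  · change (1 : F) ^ _ ∈ _
    rw [one_zpow]
    exact Subalgebra.one_mem _

end IsSkew

end Geometric

end Seed

end ClusterAlg
namespace ClusterAlg

/-! ### Algebras generated by two families. -/

section PairAlgebra

variable {A F ι : Type*} [CommRing A] [Field F] [Algebra A F]

/-- The subalgebra generated by two families of elements. -/
def pairAlgebra (A : Type*) {F ι : Type*} [CommRing A] [Field F] [Algebra A F] (u v : ι → F) :
    Subalgebra A F :=
  Algebra.adjoin A (Set.range u ∪ Set.range v)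

theorem fst_mem_pairAlgebra (u v : ι → F) (i : ι) : u i ∈ pairAlgebra A u v :=
  Algebra.subset_adjoin (Or.inl ⟨i, rfl⟩)

theorem snd_mem_pairAlgebra (u v : ι → F) (i : ι) : v i ∈ pairAlgebra A u v :=
  Algebra.subset_adjoin (Or.inr ⟨i, rfl⟩)

theorem pairAlgebra_le {u v : ι → F} {W : Subalgebra A F} (hu : ∀ i, u i ∈ W)
    (hv : ∀ i, v i ∈ W) : pairAlgebra A u v ≤ W :=
  Algebra.adjoin_le (Set.union_subset (Set.range_subset_iff.mpr hu) (Set.range_subset_iff.mpr hv))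

theorem pairAlgebra_eq_adjoin_pair (u v : ι → F) (k : ι) :
    pairAlgebra A u v = Algebra.adjoin A
      ((Algebra.adjoin A (u '' {k}ᶜ ∪ v '' {k}ᶜ) : Set F) ∪ {u k, v k}) := by
  apply le_antisymm
  · have h : ∀ i, u i ∈ Algebra.adjoin A
        ((Algebra.adjoin A (u '' {k}ᶜ ∪ v '' {k}ᶜ) : Set F) ∪ {u k, v k}) ∧
        v i ∈ Algebra.adjoin A
        ((Algebra.adjoin A (u '' {k}ᶜ ∪ v '' {k}ᶜ) : Set F) ∪ {u k, v k}) := by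
      intro i
      by_cases hi : i = k
      · subst hi
        exact ⟨Algebra.subset_adjoin (Or.inr (Or.inl rfl)),
          Algebra.subset_adjoin (Or.inr (Or.inr rfl))⟩
      · exact ⟨Algebra.subset_adjoin (Or.inl (Algebra.subset_adjoin (Or.inl ⟨i, hi, rfl⟩))),
          Algebra.subset_adjoin (Or.inl (Algebra.subset_adjoin (Or.inr ⟨i, hi, rfl⟩)))⟩
    exact pairAlgebra_le (fun i => (h i).1) fun i => (h i).2
  · refine Algebra.adjoin_le (Set.union_subset ?_ ?_)
    · refine Algebra.adjoin_le (Set.union_subset ?_ ?_)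
      · rintro _ ⟨i, -, rfl⟩
        exact fst_mem_pairAlgebra u v i
      · rintro _ ⟨i, -, rfl⟩
        exact snd_mem_pairAlgebra u v i
    · rintro _ (rfl | rfl)
      · exact fst_mem_pairAlgebra u v k
      · exact snd_mem_pairAlgebra u v k

end PairAlgebra

namespace Seed

/-! ### The cluster algebra lies in the upper cluster algebra. -/

section Symmetry

variable {n m : ℕ} {F : Type*} [Field F] [Algebra (MonoidAlgebra ℤ (Trop m)) F]

theorem laurentRing_permute (A : Subring (MonoidAlgebra ℤ (Trop m))) (t : Seed (Trop m) F n)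
    (σ : Equiv.Perm (Fin n)) : laurentRing A (t.permute σ) = laurentRing A t := by
  have h1 : Set.range (t.permute σ).x = Set.range t.x := σ.surjective.range_comp t.x
  have h2 : (Set.range fun i => ((t.permute σ).x i)⁻¹) = Set.range fun i => (t.x i)⁻¹ :=
    σ.surjective.range_comp fun i => (t.x i)⁻¹
  rw [laurentRing, laurentRing, h1, h2]

theorem IsSkew.of_reachable
    (hF : Function.Injective (algebraMap (MonoidAlgebra ℤ (Trop m)) F))
    {s t : Seed (Trop m) F n} (h : s.IsSkew)
    (hst : Relation.ReflTransGen (fun a b => ∃ k, b = Seed.mutate k a) s t) :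
    t.IsSkew ∧ Relation.ReflTransGen (fun a b => ∃ k, b = Seed.mutate k a) t s := by
  induction hst with
  | refl => exact ⟨h, .refl⟩
  | tail _ hs ih =>
    obtain ⟨k, rfl⟩ := hs
    exact ⟨ih.1.mutate hF k, .head ⟨k, (ih.1.mutate_mutate hF k).symm⟩ ih.2⟩

/-- Mutation is an involution, so any two seeds of the class are joined by mutations up to
relabeling, and the Laurent phenomenon applies with either as the initial one. -/
theorem IsSkew.clusterAlgebra_le_upperClusterAlgebra
    (hF : Function.Injective (algebraMap (MonoidAlgebra ℤ (Trop m)) F))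
    {s : Seed (Trop m) F n} (h : s.IsSkew) :
    s.clusterAlgebra (polyGroundRing m) ≤ s.upperClusterAlgebra (polyGroundRing m) := by
  refine Algebra.adjoin_le ?_
  rintro _ ⟨_, ⟨t, ht, σ, rfl⟩, i, rfl⟩
  refine Algebra.mem_iInf.mpr fun _ => Algebra.mem_iInf.mpr ?_
  rintro ⟨t', ht', τ, rfl⟩
  rw [laurentRing_permute]
  obtain ⟨h', hback⟩ := h.of_reachable hF ht'
  exact h'.cluster_mem_laurentRing hF (hback.trans ht) (σ i)

end Symmetry

/-! ### The upper cluster algebra of an acyclic seed lies in the cluster algebra. -/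

section Acyclic

variable {n m : ℕ} {F : Type*} [Field F] [Algebra (MonoidAlgebra ℤ (Trop m)) F]

/-- The result of exchanging the `k`-th cluster variable. -/
noncomputable def adjacentVar (s : Seed (Trop m) F n) (k : Fin n) : F :=
  exch s.extMat s.extCluster (Sum.inl k) / s.x k

theorem mutate_x (s : Seed (Trop m) F n) (k : Fin n) :
    (s.mutate k).x = Function.update s.x k (s.adjacentVar k) := by
  funext i
  have := congrFun (extCluster_mutate s k) (Sum.inl i)
  change (s.mutate k).x i = _ at this
  rw [this, clMut, adjacentVar]
  by_cases hi : i = k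
  · subst hi
    rw [Function.update_self, Function.update_self]
    rfl
  · rw [Function.update_of_ne hi, Function.update_of_ne (by simpa using hi)]
    rfl

theorem IsSkew.mul_adjacentVar {s : Seed (Trop m) F n} (h : s.IsSkew) (k : Fin n) :
    s.x k * s.adjacentVar k = exch s.extMat s.extCluster (Sum.inl k) :=
  mul_div_cancel₀ _ (h.ne_zero k)

theorem coeffMonomial_natCast_mem (W : Subalgebra (polyGroundRing m) F) (e : Fin m → ℕ) :
    coeffMonomial F (Multiplicative.ofAdd fun a => (e a : ℤ)) ∈ W := by
  rw [← prod_coeffMonomial_pow]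
  refine W.prod_mem fun b _ => W.pow_mem ?_ _
  exact W.algebraMap_mem
    ⟨MonoidAlgebra.of ℤ (Trop m) (Trop.z b), Subring.subset_closure ⟨b, rfl⟩⟩

theorem exch_mem (W : Subalgebra (polyGroundRing m) F) {s : Seed (Trop m) F n} {k : Fin n}
    (hW : ∀ i, s.B i k ≠ 0 → s.x i ∈ W) : exch s.extMat s.extCluster (Sum.inl k) ∈ W := by
  have hprod : ∀ e : Fin n → ℕ, (∀ i, s.B i k = 0 → e i = 0) → ∏ i, s.x i ^ e i ∈ W := by
    intro e he
    refine W.prod_mem fun i _ => ?_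
    by_cases hi : s.B i k = 0
    · rw [he i hi, pow_zero]
      exact W.one_mem
    · exact W.pow_mem (hW i hi) _
  rw [exch_ext_eq]
  exact W.add_mem
    (W.mul_mem (coeffMonomial_natCast_mem W _) (hprod _ fun i hi => by simp [hi]))
    (W.mul_mem (coeffMonomial_natCast_mem W _) (hprod _ fun i hi => by simp [hi]))

/-- Mutations at pairwise unconnected vertices do not interact. -/
theorem exists_reachable_piecewise {s : Seed (Trop m) F n} {S : Finset (Fin n)}
    (hS : ∀ i ∈ S, ∀ j ∈ S, s.B i j = 0) (T : Finset (Fin n)) (hT : T ⊆ S) :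
    ∃ t, Relation.ReflTransGen (fun a b => ∃ k, b = Seed.mutate k a) s t ∧
      t.x = T.piecewise s.adjacentVar s.x ∧
      ∀ l ∈ S, l ∉ T → ∀ e, t.extMat e (Sum.inl l) = s.extMat e (Sum.inl l) := by
  induction T using Finset.induction_on with
  | empty => exact ⟨s, .refl, by simp, fun _ _ _ _ => rfl⟩
  | insert k T hk ih =>
    obtain ⟨t, hst, htx, htB⟩ := ih fun i hi => hT (Finset.mem_insert_of_mem hi)
    have hkS : k ∈ S := hT (Finset.mem_insert_self k T)
    refine ⟨t.mutate k, hst.tail ⟨k, rfl⟩, ?_, fun l hl hlT e => ?_⟩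
    · have hadj : t.adjacentVar k = s.adjacentVar k := by
        have hx : t.x k = s.x k := by rw [htx, Finset.piecewise_eq_of_notMem _ _ _ hk]
        rw [adjacentVar, adjacentVar, hx]
        congr 1
        refine exch_congr (htB k hkS hk) fun i hi => ?_
        rcases i with i | a
        · refine (congrFun htx i).trans (Finset.piecewise_eq_of_notMem _ _ _ fun hiT => hi ?_)
          rw [htB k hkS hk]
          exact hS i (hT (Finset.mem_insert_of_mem hiT)) k hkS
        · rfl
      rw [mutate_x, hadj, htx, Finset.piecewise_insert]
    · rw [Finset.mem_insert, not_or] at hlT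
      rw [extMat_mutate, matMut_apply_of_eq_zero (by simpa using hlT.1)]
      · exact htB l hl hlT.2 e
      · rw [htB l hl hlT.2]
        exact hS k hkS l hl

variable {s : Seed (Trop m) F n}

/-- The subalgebra generated by the cluster variables, the exchanged variables in `S`, and the
inverses of the variables outside `S`. -/
noncomputable def partialAlgebra (s : Seed (Trop m) F n) (S : Finset (Fin n)) :
    Subalgebra (polyGroundRing m) F :=
  pairAlgebra _ s.x (S.piecewise s.adjacentVar fun i => (s.x i)⁻¹)

theorem IsSkew.mem_partialAlgebra_of_independent
    (hF : Function.Injective (algebraMap (MonoidAlgebra ℤ (Trop m)) F)) (h : s.IsSkew)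
    {S : Finset (Fin n)} (hS : ∀ i ∈ S, ∀ j ∈ S, s.B i j = 0) {f : F}
    (hf : ∀ t, Relation.ReflTransGen (fun a b => ∃ k, b = Seed.mutate k a) s t →
      f ∈ laurentRing (polyGroundRing m) t) : f ∈ s.partialAlgebra S := by
  -- Here T records the vertices already mutated, and D those at which the inverse is replaced by
  -- the exchanged variable. D = ∅ is the hypothesis at the seed mutated along T; enlarging D by `k`
  -- compares T with T ∪ {k}, whose algebras differ only in the generators at `k`.
  suffices H : ∀ D ⊆ S, ∀ T ⊆ S, Disjoint T D →
      f ∈ pairAlgebra (polyGroundRing m) (T.piecewise s.adjacentVar s.x)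
        (D.piecewise s.adjacentVar fun i => (T.piecewise s.adjacentVar s.x i)⁻¹) by
    simpa [partialAlgebra] using H S subset_rfl ∅ (Finset.empty_subset _) (Finset.disjoint_empty_left _)
  intro D
  induction D using Finset.induction_on with
  | empty =>
    intro _ T hT _
    obtain ⟨t, hst, htx, -⟩ := exists_reachable_piecewise hS T hT
    have := hf t hst
    rw [Finset.piecewise_empty, ← htx]
    exact this
  | insert k D hk ih =>
    intro hD T hT hTD
    rw [Finset.disjoint_insert_right] at hTD
    have hkS : k ∈ S := hD (Finset.mem_insert_self k D)
    have hDS : D ⊆ S := fun i hi => hD (Finset.mem_insert_of_mem hi)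
    have h1 := ih hDS T hT hTD.2
    have h2 := ih hDS (insert k T) (Finset.insert_subset hkS hT)
      (Finset.disjoint_insert_left.mpr ⟨hk, hTD.2⟩)
    rw [pairAlgebra_eq_adjoin_pair _ _ k] at h1 h2 ⊢
    have hT' : ∀ i ∈ ({k}ᶜ : Set (Fin n)), (insert k T).piecewise s.adjacentVar s.x i =
        T.piecewise s.adjacentVar s.x i := fun i hi => by
      rw [Finset.piecewise_insert, Function.update_of_ne hi]
    have hv2 : ∀ i ∈ ({k}ᶜ : Set (Fin n)), D.piecewise s.adjacentVar
        (fun i => ((insert k T).piecewise s.adjacentVar s.x i)⁻¹) i =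
        D.piecewise s.adjacentVar (fun i => (T.piecewise s.adjacentVar s.x i)⁻¹) i :=
      fun i hi => by
        simp only [Finset.piecewise]
        have := hT' i hi
        simp only [Finset.piecewise] at this
        rw [this]
    have hv3 : ∀ i ∈ ({k}ᶜ : Set (Fin n)), (insert k D).piecewise s.adjacentVar
        (fun i => (T.piecewise s.adjacentVar s.x i)⁻¹) i =
        D.piecewise s.adjacentVar (fun i => (T.piecewise s.adjacentVar s.x i)⁻¹) i :=
      fun i hi => by rw [Finset.piecewise_insert, Function.update_of_ne hi]
    rw [Set.image_congr hT', Set.image_congr hv2] at h2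
    rw [Set.image_congr hv3]
    rw [Finset.piecewise_insert_self, Finset.piecewise_eq_of_notMem _ _ _ hk,
      Finset.piecewise_insert_self] at h2
    rw [Finset.piecewise_eq_of_notMem _ _ _ hTD.1, Finset.piecewise_eq_of_notMem _ _ _ hk,
      Finset.piecewise_eq_of_notMem _ _ _ hTD.1] at h1
    rw [Finset.piecewise_eq_of_notMem _ _ _ hTD.1, Finset.piecewise_insert_self]
    set R := Algebra.adjoin (polyGroundRing m) (T.piecewise s.adjacentVar s.x '' {k}ᶜ ∪
      (D.piecewise s.adjacentVar fun i => (T.piecewise s.adjacentVar s.x i)⁻¹) '' {k}ᶜ) with hR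
    set K := Subfield.closure (Set.range (algebraMap (MonoidAlgebra ℤ (Trop m)) F)) with hK
    let E := IntermediateField.adjoin K (s.x '' {k}ᶜ)
    have hcE : ∀ r, algebraMap (MonoidAlgebra ℤ (Trop m)) F r ∈ E := fun r =>
      E.algebraMap_mem ⟨_, Subfield.subset_closure ⟨r, rfl⟩⟩
    let EA : Subalgebra (polyGroundRing m) F :=
      { E.toSubfield.toSubring with algebraMap_mem' := fun r => hcE r }
    have hxE : ∀ i, i ≠ k → s.x i ∈ E := fun i hi =>
      IntermediateField.subset_adjoin K _ (Set.mem_image_of_mem _ hi)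
    have hx'E : ∀ i ∈ S, i ≠ k → s.adjacentVar i ∈ E := fun i hi hik => by
      refine div_mem ?_ (hxE i hik)
      refine exch_mem EA fun j hj => hxE j ?_
      rintro rfl
      exact hj (hS _ hkS _ hi)
    have hwE : ∀ i, i ≠ k → T.piecewise s.adjacentVar s.x i ∈ E := fun i hi => by
      by_cases hiT : i ∈ T
      · rw [Finset.piecewise_eq_of_mem _ _ _ hiT]
        exact hx'E i (hT hiT) hi
      · rw [Finset.piecewise_eq_of_notMem _ _ _ hiT]
        exact hxE i hi
    have hRE : R ≤ EA := by
      refine Algebra.adjoin_le (Set.union_subset ?_ ?_)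
      · rintro _ ⟨i, hi, rfl⟩
        exact hwE i hi
      · rintro _ ⟨i, hi, rfl⟩
        change _ ∈ E
        by_cases hiD : i ∈ D
        · rw [Finset.piecewise_eq_of_mem _ _ _ hiD]
          exact hx'E i (hDS hiD) hi
        · rw [Finset.piecewise_eq_of_notMem _ _ _ hiD]
          exact inv_mem (hwE i hi)
    refine mem_adjoin_pair_of_mem_laurent R E.toSubfield (fun r hr => hRE hr)
      (AlgebraicIndependent.transcendental_adjoin_compl h.indep k)
      (P := exch s.extMat s.extCluster (Sum.inl k)) (exch_mem R fun i hi => ?_)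
      (h.exch_ne_zero hF k) h1 h2
    -- Neighbours of `k` lie outside S, so they are never mutated and the exchange binomial at `k`
    -- lies in `R`.
    have hiS : i ∉ S := fun hiS => hi (hS i hiS k hkS)
    have hik : i ≠ k := fun e => hiS (e ▸ hkS)
    refine Algebra.subset_adjoin (Or.inl ⟨i, hik, ?_⟩)
    exact Finset.piecewise_eq_of_notMem _ _ _ fun hiT => hiS (hT hiT)

/-- Removing `i` from S trades the exchanged variable for x_i⁻¹, which costs at most a localization
at x_i. -/
theorem IsSkew.exists_pow_mul_mem_partialAlgebra (h : s.IsSkew) {S : Finset (Fin n)} {i : Fin n}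
    {f : F} (hf : f ∈ s.partialAlgebra (S.erase i)) :
    ∃ N : ℕ, s.x i ^ N * f ∈ s.partialAlgebra S := by
  refine exists_pow_mul_mem_of_mem_adjoin _ (fst_mem_pairAlgebra _ _ i) ?_ hf
  rintro _ (⟨j, rfl⟩ | ⟨j, rfl⟩)
  · exact ⟨0, by simpa using fst_mem_pairAlgebra _ _ j⟩
  · by_cases hj : j = i
    · subst hj
      refine ⟨1, ?_⟩
      rw [Finset.piecewise_eq_of_notMem _ _ _ (Finset.notMem_erase _ _), pow_one,
        mul_inv_cancel₀ (h.ne_zero j)]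
      exact one_mem _
    · refine ⟨0, ?_⟩
      have := snd_mem_pairAlgebra (A := polyGroundRing m) s.x
        (S.piecewise s.adjacentVar fun i => (s.x i)⁻¹) j
      rw [pow_zero, one_mul]
      convert this using 1
      simp [Finset.piecewise, hj]

/-- In x_i x_i' = z x_j r + q the monomial q involves only variables outside S, as `i` is a source
of S. It has no frozen factor, since `hy` makes the negative parts of the exponents vanish; frozen
variables are not inverted here. So q is a unit and x_i, x_j are comaximal. -/
theorem IsSkew.mem_partialAlgebra_of_source (h : s.IsSkew) (hy : ∀ i a, 0 ≤ (s.y i).toAdd a)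
    {S : Finset (Fin n)} {i j : Fin n} (hi : i ∈ S) (hsrc : ∀ l ∈ S, 0 ≤ s.B l i)
    (hij : 0 < s.B j i) {f : F} (hfi : f ∈ s.partialAlgebra (S.erase i))
    (hfj : f ∈ s.partialAlgebra (S.erase j)) : f ∈ s.partialAlgebra S := by
  obtain ⟨N, hN⟩ := h.exists_pow_mul_mem_partialAlgebra hfi
  obtain ⟨M, hM⟩ := h.exists_pow_mul_mem_partialAlgebra hfj
  set W := s.partialAlgebra S
  have hxW : ∀ l, s.x l ∈ W := fst_mem_pairAlgebra _ _
  have hx' : s.adjacentVar i ∈ W := by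
    have := snd_mem_pairAlgebra (A := polyGroundRing m) s.x
      (S.piecewise s.adjacentVar fun i => (s.x i)⁻¹) i
    rwa [Finset.piecewise_eq_of_mem _ _ _ hi] at this
  have hinv : ∀ l ∉ S, (s.x l)⁻¹ ∈ W := fun l hl => by
    have := snd_mem_pairAlgebra (A := polyGroundRing m) s.x
      (S.piecewise s.adjacentVar fun i => (s.x i)⁻¹) l
    rwa [Finset.piecewise_eq_of_notMem _ _ _ hl] at this
  set q := ∏ l, s.x l ^ (-s.B l i).toNat with hq
  have hq0 : q ≠ 0 := Finset.prod_ne_zero_iff.mpr fun l _ => pow_ne_zero _ (h.ne_zero l)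
  have hqinv : q⁻¹ ∈ W := by
    rw [hq, ← Finset.prod_inv_distrib]
    refine W.prod_mem fun l _ => ?_
    by_cases hl : l ∈ S
    · rw [Int.toNat_of_nonpos (by simpa using hsrc l hl), pow_zero, inv_one]
      exact W.one_mem
    · rw [← inv_pow]
      exact W.pow_mem (hinv l hl) _
  set z := coeffMonomial F (Multiplicative.ofAdd fun a => (((s.y i).toAdd a).toNat : ℤ))
  have hz : z ∈ W := coeffMonomial_natCast_mem W _
  obtain ⟨r, hr, hpr⟩ : ∃ r ∈ W, ∏ l, s.x l ^ (s.B l i).toNat = s.x j * r := by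
    refine ⟨s.x j ^ ((s.B j i).toNat - 1) * ∏ l ∈ Finset.univ.erase j, s.x l ^ (s.B l i).toNat,
      W.mul_mem (W.pow_mem (hxW j) _) (W.prod_mem fun l _ => W.pow_mem (hxW l) _), ?_⟩
    rw [← Finset.mul_prod_erase _ _ (Finset.mem_univ j), ← mul_assoc, mul_pow_sub_one]
    omega
  have hexch : s.x i * s.adjacentVar i = z * (s.x j * r) + q := by
    rw [h.mul_adjacentVar, exch_ext_eq, hpr]
    have : (Multiplicative.ofAdd fun a => ((-(s.y i).toAdd a).toNat : ℤ) : Trop m) = 1 := by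
      apply Multiplicative.toAdd.injective
      funext a
      have := hy i a
      change ((-(s.y i).toAdd a).toNat : ℤ) = 0
      omega
    rw [this, map_one, one_mul]
  refine mem_of_comaximal W (hxW i) (hxW j) (u := q⁻¹ * s.adjacentVar i) (v := -(q⁻¹ * (z * r)))
    (W.mul_mem hqinv hx') (W.neg_mem (W.mul_mem hqinv (W.mul_mem hz hr))) ?_ hN hM
  have := inv_mul_cancel₀ hq0
  linear_combination q⁻¹ * hexch + this

theorem IsSkew.mem_partialAlgebra
    (hF : Function.Injective (algebraMap (MonoidAlgebra ℤ (Trop m)) F)) (h : s.IsSkew)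
    (hy : ∀ i a, 0 ≤ (s.y i).toAdd a)
    (hac : ∀ i, ¬ Relation.TransGen (fun a b => 0 < s.B b a) i i) {f : F}
    (hf : ∀ t, Relation.ReflTransGen (fun a b => ∃ k, b = Seed.mutate k a) s t →
      f ∈ laurentRing (polyGroundRing m) t) (S : Finset (Fin n)) : f ∈ s.partialAlgebra S := by
  induction S using Finset.strongInduction with
  | H S ih =>
    by_cases hS : ∀ i ∈ S, ∀ j ∈ S, s.B i j = 0
    · exact h.mem_partialAlgebra_of_independent hF hS hf
    -- Restricting to vertices that emit an arrow inside S ensures that the minimal one comes with a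
    -- target `j`. It is a source of S, since any predecessor in S would belong to this set and
    -- precede it.
    have hne : {i | i ∈ S ∧ ∃ j ∈ S, 0 < s.B j i}.Nonempty := by
      push Not at hS
      obtain ⟨i, hi, j, hj, hij⟩ := hS
      rcases lt_or_gt_of_ne hij with h0 | h0
      · exact ⟨i, hi, j, hj, by rw [h.skew]; omega⟩
      · exact ⟨j, hj, i, hi, h0⟩
    let r : Fin n → Fin n → Prop := Relation.TransGen fun a b => 0 < s.B b a
    have : Std.Irrefl r := ⟨hac⟩
    obtain ⟨i, ⟨hi, j, hj, hij⟩, hmin⟩ :=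
      (Finite.wellFounded_of_trans_of_irrefl r).has_min _ hne
    refine h.mem_partialAlgebra_of_source hy hi (fun l hl => ?_) hij
      (ih _ (Finset.erase_ssubset hi)) (ih _ (Finset.erase_ssubset hj))
    by_contra hneg
    have hil : 0 < s.B i l := by
      rw [h.skew]
      omega
    exact hmin l ⟨hl, i, hi, hil⟩ (.single hil)

/-- For the full index set no inverses remain among the generators of `partialAlgebra`: they are the
initial variables and their one-step exchanges. -/
theorem IsSkew.upperClusterAlgebra_le_clusterAlgebra
    (hF : Function.Injective (algebraMap (MonoidAlgebra ℤ (Trop m)) F)) (h : s.IsSkew)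
    (hy : ∀ i a, 0 ≤ (s.y i).toAdd a)
    (hac : ∀ i, ¬ Relation.TransGen (fun a b => 0 < s.B b a) i i) :
    s.upperClusterAlgebra (polyGroundRing m) ≤ s.clusterAlgebra (polyGroundRing m) := by
  intro f hf
  have hf' := h.mem_partialAlgebra hF hy hac (f := f) (fun t ht =>
    Algebra.mem_iInf.mp (Algebra.mem_iInf.mp hf t) ⟨t, ht, 1, rfl⟩) Finset.univ
  refine pairAlgebra_le (fun i => ?_) (fun i => ?_) hf'
  · exact Algebra.subset_adjoin ⟨s, ⟨s, .refl, 1, rfl⟩, i, rfl⟩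
  · refine Algebra.subset_adjoin ⟨s.mutate i, ⟨_, .single ⟨i, rfl⟩, 1, rfl⟩, i, ?_⟩
    rw [mutate_x, Function.update_self, Finset.piecewise_univ]

end Acyclic

end Seed

/-! ### Translation from quivers. -/

namespace IceQuiver

variable {n m : ℕ} {F : Type*}

theorem toAdd_seed_y (Q : IceQuiver n m) (x : Fin n → F) (i : Fin n) (a : Fin m) :
    ((Q.seed x).y i).toAdd a =
      (Q.arrows (Sum.inl i) (Sum.inr a) : ℤ) - (Q.arrows (Sum.inr a) (Sum.inl i) : ℤ) := by
  simp only [seed]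
  rw [toAdd_prod]
  simp [Trop.z, Finset.sum_apply, Pi.single_apply]

variable [Field F] [Algebra (MonoidAlgebra ℤ (Trop m)) F]

theorem isSkew_seed (Q : IceQuiver n m) {x : Fin n → F} (hx : (Q.seed x).IsSeed) :
    (Q.seed x).IsSkew where
  skew _ _ := (neg_sub _ _).symm
  indep := hx.algebraicIndependent

end IceQuiver

end ClusterAlg

theorem corollary3p7 {n m : ℕ} {F : Type*} [Field F]
    [Algebra (MonoidAlgebra ℤ (ClusterAlg.Trop m)) F]
    (hF : Function.Injective (algebraMap (MonoidAlgebra ℤ (ClusterAlg.Trop m)) F))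
    (Q : ClusterAlg.IceQuiver n m) (x : Fin n → F) (hx : (Q.seed x).IsSeed)
    (hacyc : Q.IsAcyclic) (hsf : Q.IsSourceFreezing) :
    (Q.seed x).clusterAlgebra (ClusterAlg.polyGroundRing m) =
      (Q.seed x).upperClusterAlgebra (ClusterAlg.polyGroundRing m) := by
  have h := Q.isSkew_seed hx
  refine le_antisymm (h.clusterAlgebra_le_upperClusterAlgebra hF)
    (h.upperClusterAlgebra_le_clusterAlgebra hF (fun i a => ?_) fun i hi => hacyc i ?_)
  · rw [ClusterAlg.IceQuiver.toAdd_seed_y, hsf]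
    simp
  · refine Relation.TransGen.mono (fun a b hab => ?_) i i hi
    change 0 < (Q.arrows (Sum.inl a) (Sum.inl b) : ℤ) - (Q.arrows (Sum.inl b) (Sum.inl a) : ℤ)
      at hab
    omega
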